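/- Let $\lambda=(\lambda_n)_{n\ge1}$ be a frequency, i.e. a strictly increasing sequence of nonnegative real numbers tending to $+\infty$, and suppose that $\lambda$ satisfies (NC): for every $\delta>0$ there is $C>0$ such that for every $n\ge1$ there is $m>n$ with $$\log\left(\frac{\lambda_m+\lambda_n}{\lambda_m-\lambda_n}\right)+(m-n)\le Ce^{\delta\lambda_n}.$$ A $\lambda$-Dirichlet group $(G,\beta)$ is a compact (Hausdorff) abelian group $G$ together with a continuous homomorphism $\beta:(\mathbb R,+)\to G$ with dense range such that for every $n$ there is a (necessarily unique) continuous character $h_{\lambda_n}$ of $G$ with $h_{\lambda_n}(\beta(t))=e^{-i\lambda_nt}$ for all $t\in\mathbb R$. Let $G$ carry its normalized Haar measure, and write $\widehat f(\chi)=\int_G f\,\overline{\chi}$ for $f\in L^1(G)$ and $\chi\in\widehat G$. For $1\le p\le\infty$ let $H_p^\lambda(G)$ be the space of $f\in L^p(G)$ with $\{\chi\in\widehat G:\widehat f(\chi)\neq0\}\subset\{h_{\lambda_n}:n\ge1\}$, and put $S_nf=\sum_{k=1}^n\widehat f(h_{\lambda_k})h_{\lambda_k}$. Then for every $\delta>0$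 there is a constant $C>0$, depending only on $\lambda$ and $\delta$, such that for every $\lambda$-Dirichlet group $(G,\beta)$, every $p\in[1,\infty]$ and every $f\in H_p^\lambda(G)$, $$\Big\|\sup_{n\le N}|S_nf|\Big\|_{L^p(G)}\le Ce^{\delta\lambda_N}\|f\|_{L^p(G)}\quad\text{for all }N\ge1,\qquad\text{and}\qquad \Big\|\sup_{N\ge1}e^{-\delta\lambda_N}|S_Nf|\Big\|_{L^p(G)}\le C\|f\|_{L^p(G)}.$$ -/

import Mathlib

open MeasureTheory Filter
open scoped ENNReal ComplexConjugate

/-- A frequency: a (strictly) increasing sequence of nonnegative reals tending to `+∞`.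
Sequences are indexed from `0`: `lam 0, lam 1, …` are the terms `λ₁, λ₂, …`. -/
structure IsFrequency (lam : ℕ → ℝ) : Prop where
  nonneg : ∀ n, 0 ≤ lam n
  strictMono : StrictMono lam
  tendsto_atTop : Tendsto lam atTop atTop

/-- Condition (NC). -/
def SatisfiesNC (lam : ℕ → ℝ) : Prop :=
  ∀ δ : ℝ, 0 < δ → ∃ C : ℝ, 0 < C ∧ ∀ n : ℕ, ∃ m : ℕ, n < m ∧
    Real.log ((lam m + lam n) / (lam m - lam n)) + ((m : ℝ) - (n : ℝ))
      ≤ C * Real.exp (δ * lam n)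

/-- The structure of a `λ`-Dirichlet group on a topological group `G`: a continuous homomorphism
`β : (ℝ, +) → G` with dense range, such that for every `n` there is a continuous character `h n`
of `G` with `h n ∘ β = e^{-i λ_n ·}` (it is unique, since `β` has dense range). -/
structure DirichletGroup (lam : ℕ → ℝ) (G : Type*) [CommGroup G] [TopologicalSpace G] where
  β : Multiplicative ℝ →ₜ* G
  denseRange : DenseRange β
  h : ℕ → PontryaginDual G
  h_comp_β : ∀ (n : ℕ) (t : ℝ),
    ((h n (β (Multiplicative.ofAdd t)) : Circle) : ℂ)
      = Complex.exp (-(Complex.I * (lam n : ℂ) * (t : ℂ)))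

/-- The Fourier coefficient of `f` at the character `χ`. -/
noncomputable def fourierCoefficient {G : Type*} [CommGroup G] [TopologicalSpace G]
    [MeasurableSpace G] (μ : Measure G) (f : G → ℂ) (χ : PontryaginDual G) : ℂ :=
  ∫ ω, f ω * conj ((χ ω : Circle) : ℂ) ∂μ

namespace DirichletGroup

/-- `f` belongs to the Hardy space `H_p^λ(G)`: it is in `L^p(G)` and its Fourier transform is
supported in the set of the characters `h n`. -/
def MemHardy {lam : ℕ → ℝ} {G : Type*} [CommGroup G] [TopologicalSpace G]
    [MeasurableSpace G] (D : DirichletGroup lam G) (μ : Measure G) (p : ℝ≥0∞)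
    (f : G → ℂ) : Prop :=
  MemLp f p μ ∧ Function.support (fourierCoefficient μ f) ⊆ Set.range D.h

/-- The partial sum of the Fourier series of `f` over the characters `h 0, …, h n`. -/
noncomputable def partialSum {lam : ℕ → ℝ} {G : Type*} [CommGroup G] [TopologicalSpace G]
    [MeasurableSpace G] (D : DirichletGroup lam G) (μ : Measure G) (f : G → ℂ) (n : ℕ)
    (ω : G) : ℂ :=
  ∑ k ∈ Finset.range (n + 1), fourierCoefficient μ f (D.h k) * ((D.h k ω : Circle) : ℂ)

end DirichletGroup

/-! Given `n`, take `m > n` from (NC) and a de la Vallée-Poussin kernel ψ on ℝ whose Fourier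
transform is 1 on [-λ_n, λ_n] and 0 beyond some B ≤ λ_m. The average ω ↦ ∫ ψ(t) f(ω β(t)) dt has its
coefficient at h_k multiplied by the transform of ψ at λ_k. It is therefore S_n f plus fewer than m
- n further terms, each of size at most ‖f‖₁ (`enorm_partialSum_le`).

For the maximal inequality, the kernels belonging to all λ_n ≤ x are dominated by one function, a
multiple of min(M, 1/|t|, 2/(d t²)), whose integral is O(1 + log(M/d)). By (NC) one may take M = x +
1 and log(1/d) = O(e^{δx}) (`SatisfiesNC.exists_majorant`). Hence |S_n f| is at most an average of
|f| against a fixed weight w, plus c‖f‖₁, almost everywhere and for all these n at once, where ∫ w +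
c = O(e^{δx}). Minkowski's inequality (`eLpNorm_lintegral_comp_le`) gives the first bound for every
p, endpoints included. The second follows by summing the majorants for x = 0, 1, 2, … (built with
δ/2) against weights comparable to e^{-δx}.

Identifying the average with a trigonometric polynomial requires uniqueness of Fourier coefficients
on G, hence enough characters (`exists_character_apply_ne_one`). These come from the spectral theory
of compact self-adjoint convolution operators. -/

/-! ### Characters of a compact abelian group separate points. -/

section JointEigenvector

/-- A commuting family of endomorphisms preserving a nonzero finite-dimensional subspace has a
common eigenvector in it. -/
theorem exists_common_eigenvector {V ι : Type*} [AddCommGroup V] [Module ℂ V]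
    (L : ι → Module.End ℂ V) (hL : ∀ i j, Commute (L i) (L j)) (W : Submodule ℂ V)
    [FiniteDimensional ℂ W] (hW : W ≠ ⊥) (hinv : ∀ i, ∀ w ∈ W, L i w ∈ W) :
    ∃ w ∈ W, w ≠ 0 ∧ ∃ c : ι → ℂ, ∀ i, L i w = c i • w := by
  induction hn : Module.finrank ℂ W using Nat.strong_induction_on generalizing W with
  | _ n ih =>
    by_cases h : ∀ i, ∃ c : ℂ, ∀ w ∈ W, L i w = c • w
    · choose c hc using h
      obtain ⟨w, hw, hw0⟩ := W.ne_bot_iff.1 hW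
      exact ⟨w, hw, hw0, c, fun i ↦ hc i w hw⟩
    · push Not at h
      obtain ⟨i, hi⟩ := h
      have : Nontrivial W := Submodule.nontrivial_iff_ne_bot.2 hW
      obtain ⟨c, hc⟩ := Module.End.exists_eigenvalue ((L i).restrict (hinv i))
      obtain ⟨v, hv⟩ := hc.exists_hasEigenvector
      have hv1 : L i v = c • (v : V) := congrArg Subtype.val hv.apply_eq_smul
      -- As `L i` is not scalar on `W`, this eigenspace is strictly smaller; commutation makes it
      -- invariant under the whole family, so induction on the dimension applies.
      let W' : Submodule ℂ V := W ⊓ Module.End.eigenspace (L i) c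
      have hW'W : W' < W := by
        refine lt_of_le_of_ne inf_le_left fun he ↦ ?_
        obtain ⟨w, hw, hwc⟩ := hi c
        rw [← he] at hw
        exact hwc (Module.End.mem_eigenspace_iff.1 hw.2)
      have : FiniteDimensional ℂ W' := Submodule.finiteDimensional_of_le hW'W.le
      have hW' : W' ≠ ⊥ := (Submodule.ne_bot_iff _).2
        ⟨v, ⟨v.2, Module.End.mem_eigenspace_iff.2 hv1⟩, fun h0 ↦ hv.2 (Subtype.ext h0)⟩
      obtain ⟨w, hw, h⟩ := ih _ (hn ▸ Submodule.finrank_lt_finrank_of_lt hW'W) W' hW'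
        (fun j w hw ↦ ⟨hinv j w hw.1, Module.End.mem_eigenspace_iff.2 (by
          have h1 := congrArg (· w) (hL i j).eq
          simp only [Module.End.mul_apply] at h1
          rw [h1, Module.End.mem_eigenspace_iff.1 hw.2, map_smul])⟩) rfl
      exact ⟨w, hW'W.le hw, h⟩

end JointEigenvector

section InnerOperator

variable {X H : Type*} [TopologicalSpace X] [CompactSpace X] [NormedAddCommGroup H]
  [InnerProductSpace ℂ H]

/-- The operator sending `v` to the continuous function `x ↦ ⟪k x, v⟫`. -/
noncomputable def innerOperator (k : C(X, H)) : H →L[ℂ] C(X, ℂ) :=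
  LinearMap.mkContinuous
    { toFun := fun v ↦ ⟨fun x ↦ inner ℂ (k x) v, by fun_prop⟩
      map_add' := fun v w ↦ by ext x; simp
      map_smul' := fun c v ↦ by ext x; simp }
    ‖k‖ fun v ↦ (ContinuousMap.norm_le _ (by positivity)).2 fun x ↦
      (norm_inner_le_norm _ _).trans (by gcongr; exact k.norm_coe_le_norm x)

/-- Arzelà–Ascoli: on the unit ball the images are bounded by `‖k‖`, and |⟪k x - k y, v⟫| ≤ ‖k x - k
y‖ makes them equicontinuous. -/
theorem isCompactOperator_innerOperator (k : C(X, H)) : IsCompactOperator (innerOperator k) := by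
  let e := ContinuousMap.linearIsometryBoundedOfCompact X ℂ ℂ
  have h : IsCompactOperator
      (e.toContinuousLinearEquiv.toContinuousLinearMap ∘L innerOperator k) := by
    refine (isCompactOperator_iff_isCompact_closure_image_closedBall
      (e.toContinuousLinearEquiv.toContinuousLinearMap ∘L innerOperator k).toLinearMap
      one_pos).2 ?_
    refine BoundedContinuousFunction.arzela_ascoli (Metric.closedBall 0 ‖k‖)
      (isCompact_closedBall _ _) _ ?_ ?_
    · rintro _ x ⟨v, hv, rfl⟩
      rw [mem_closedBall_zero_iff] at hv ⊢
      refine (norm_inner_le_norm (k x) v).trans ?_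
      exact (mul_le_mul (k.norm_coe_le_norm x) hv (norm_nonneg _) (norm_nonneg _)).trans_eq
        (mul_one _)
    · intro x
      rw [Metric.equicontinuousAt_iff_right]
      intro ε hε
      filter_upwards [(k.continuous.tendsto x) (Metric.ball_mem_nhds _ hε)] with y hy
      rintro ⟨_, v, hv, rfl⟩
      rw [mem_closedBall_zero_iff] at hv
      rw [Set.mem_preimage, Metric.mem_ball, dist_eq_norm] at hy
      change dist (inner ℂ (k x) v) (inner ℂ (k y) v) < ε
      rw [dist_comm, dist_eq_norm, ← inner_sub_left]
      refine (norm_inner_le_norm _ _).trans_lt (lt_of_le_of_lt ?_ hy)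
      exact (mul_le_mul_of_nonneg_left hv (norm_nonneg _)).trans_eq (mul_one _)
  have he : innerOperator k = e.symm.toContinuousLinearEquiv.toContinuousLinearMap ∘L
      (e.toContinuousLinearEquiv.toContinuousLinearMap ∘L innerOperator k) := by
    ext v x
    simp
  rw [he]
  exact h.clm_comp e.symm.toContinuousLinearEquiv.toContinuousLinearMap

end InnerOperator

/-- On the eigenspace the operator is `r • id`, so the identity there is compact and Riesz's theorem
applies. -/
theorem finiteDimensional_eigenspace_of_isCompactOperator {E : Type*} [NormedAddCommGroup E]
    [NormedSpace ℂ E] [CompleteSpace E] (T : E →L[ℂ] E) (hT : IsCompactOperator T) (r : ℂ) (hr : r ≠ 0) :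
    FiniteDimensional ℂ (Module.End.eigenspace T.toLinearMap r) := by
  have hcl : IsClosed (Module.End.eigenspace T.toLinearMap r : Set E) := by
    have : (Module.End.eigenspace T.toLinearMap r : Set E) = {x | T x = r • x} := by
      ext x; exact Module.End.mem_eigenspace_iff
    rw [this]
    exact isClosed_eq T.continuous (continuous_const_smul r)
  have := hcl.completeSpace_coe
  replace hT := hT.restrict' ((Module.End.mem_invtSubmodule_iff_forall_mem_of_mem _).mp
    (Module.End.eigenspace_mem_invtSubmodule T.toLinearMap r))
  rw [Module.End.restrict_eigenspace, LinearMap.coe_smul,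
    IsCompactOperator.smul_iff₀ hr] at hT
  rwa [← isCompactOperator_id_iff_finiteDimensional (𝕜 := ℂ)]

section Characters

variable {G : Type*} [CommGroup G] [TopologicalSpace G]

/-- A nonzero continuous function that is an eigenvector of all translations is a multiple of a
character. -/
theorem exists_character_of_translation_eigenvector [CompactSpace G] (w : C(G, ℂ)) (hw : w ≠ 0) (c : G → ℂ)
    (hc : ∀ b x, w (b * x) = c b * w x) : ∃ χ : PontryaginDual G, ∀ x, (χ x : ℂ) = c x := by
  have h1 : w 1 ≠ 0 := fun h ↦ hw (by ext x; simpa [h] using hc x 1)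
  have hcw : ∀ b, c b = w b / w 1 := fun b ↦ by
    rw [eq_div_iff h1, ← hc, mul_one]
  have hone : c 1 = 1 := by rw [hcw, div_self h1]
  have hmul : ∀ a b, c (a * b) = c a * c b := fun a b ↦ by
    rw [hcw (a * b), hc, hcw b, mul_div_assoc]
  have hcont : Continuous c := by
    rw [funext hcw]; fun_prop
  let φ : G →* ℂ := ⟨⟨c, hone⟩, hmul⟩
  -- A bounded homomorphism has |c| ≤ 1, since powers of a larger value are unbounded; applying this
  -- to inverses gives |c| = 1.
  obtain ⟨R, hR⟩ := (isCompact_range hcont.norm).bddAbove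
  have hle : ∀ x, ‖c x‖ ≤ 1 := fun x ↦ by
    by_contra! h
    obtain ⟨n, hn⟩ := pow_unbounded_of_one_lt R h
    have h2 : ‖c (x ^ n)‖ ≤ R := hR ⟨_, rfl⟩
    rw [show c (x ^ n) = c x ^ n from map_pow φ x n, norm_pow] at h2
    linarith
  have hnorm : ∀ x, ‖c x‖ = 1 := fun x ↦ by
    refine le_antisymm (hle x) ?_
    have h2 : c x * c x⁻¹ = 1 := by rw [← hmul, mul_inv_cancel, hone]
    have h3 : ‖c x‖ * ‖c x⁻¹‖ = 1 := by rw [← norm_mul, h2, norm_one]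
    nlinarith [hle x⁻¹, norm_nonneg (c x)]
  let χ : G →ₜ* Circle :=
    { toFun := fun x ↦ ⟨c x, mem_sphere_zero_iff_norm.2 (hnorm x)⟩
      map_one' := Subtype.ext hone
      map_mul' := fun a b ↦ Subtype.ext (hmul a b)
      continuous_toFun := hcont.subtype_mk _ }
  exact ⟨χ, fun _ ↦ rfl⟩

/-- The kernel `(x, y) ↦ κ (x y⁻¹)` as a continuous family of continuous functions. -/
noncomputable def convolutionKernel [IsTopologicalGroup G] (κ : C(G, ℝ)) : C(G, C(G, ℂ)) :=
  ContinuousMap.curry ⟨fun z : G × G ↦ ((κ (z.1 * z.2⁻¹) : ℝ) : ℂ), by fun_prop⟩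

@[simp]
theorem convolutionKernel_apply [IsTopologicalGroup G] (κ : C(G, ℝ)) (x y : G) :
    convolutionKernel κ x y = ((κ (x * y⁻¹) : ℝ) : ℂ) := rfl

variable [IsTopologicalGroup G] [CompactSpace G] [MeasurableSpace G] [BorelSpace G]
  (μ : Measure G) [μ.IsHaarMeasure]

/-- Convolution with `κ`, as an operator from `L²` to continuous functions. -/
noncomputable def convolutionOperator (κ : C(G, ℝ)) : Lp ℂ 2 μ →L[ℂ] C(G, ℂ) :=
  innerOperator ⟨fun x ↦ ContinuousMap.toLp 2 μ ℂ (convolutionKernel κ x), by fun_prop⟩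

theorem convolutionOperator_toLp (κ : C(G, ℝ)) (w : C(G, ℂ)) (x : G) :
    convolutionOperator μ κ (ContinuousMap.toLp 2 μ ℂ w) x =
      ∫ y, w y * ((κ (x * y⁻¹) : ℝ) : ℂ) ∂μ := by
  change inner ℂ (ContinuousMap.toLp 2 μ ℂ (convolutionKernel κ x)) _ = _
  rw [ContinuousMap.inner_toLp]
  simp

/-- Density reduces this to continuous functions, where it is Fubini: κ is real and even, so the
kernel κ(x y⁻¹) is Hermitian. -/
theorem isSymmetric_convolutionOperator [μ.Regular] (κ : C(G, ℝ)) (hκ : ∀ x, κ x⁻¹ = κ x) :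
    ((ContinuousMap.toLp 2 μ ℂ) ∘L convolutionOperator μ κ).IsSymmetric := by
  intro u v
  have hd : DenseRange (ContinuousMap.toLp 2 μ ℂ : C(G, ℂ) →L[ℂ] Lp ℂ 2 μ) :=
    ContinuousMap.toLp_denseRange _ _ ℂ (by simp)
  refine hd.induction_on₂ (p := fun u v ↦
    inner ℂ (((ContinuousMap.toLp 2 μ ℂ) ∘L convolutionOperator μ κ) u) v =
    inner ℂ u (((ContinuousMap.toLp 2 μ ℂ) ∘L convolutionOperator μ κ) v)) ?_ ?_ u v
  · exact isClosed_eq (by fun_prop) (by fun_prop)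
  · intro u v
    simp only [ContinuousLinearMap.comp_apply, ContinuousMap.inner_toLp,
      convolutionOperator_toLp]
    simp_rw [← integral_conj, ← integral_const_mul, ← integral_mul_const]
    rw [integral_integral_swap_of_hasCompactSupport _ (HasCompactSupport.of_compactSpace _)]
    · congr! 4 with x y
      have : κ (y * x⁻¹) = κ (x * y⁻¹) := by rw [← hκ]; simp
      simp [this]
      ring
    · fun_prop

/-- Convolution commutes with translations by invariance of Haar measure; its eigenspaces are
therefore translation-invariant. -/
theorem convolutionOperator_translate (κ : C(G, ℝ)) (w w' : C(G, ℂ)) (b x : G)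
    (hw : ∀ y, w' y = w (b * y)) :
    convolutionOperator μ κ (ContinuousMap.toLp 2 μ ℂ w') x =
      convolutionOperator μ κ (ContinuousMap.toLp 2 μ ℂ w) (b * x) := by
  rw [convolutionOperator_toLp, convolutionOperator_toLp,
    ← integral_mul_left_eq_self (fun y ↦ w y * _) b]
  congr 1 with y
  rw [hw, show b * x * (b * y)⁻¹ = x * y⁻¹ by
    rw [mul_inv, mul_mul_mul_comm, mul_inv_cancel, one_mul]]

theorem exists_eigenvector_convolutionOperator [μ.Regular] (κ : C(G, ℝ)) (hκ : ∀ x, κ x⁻¹ = κ x)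
    (hκ1 : κ 1 ≠ 0) :
    ∃ r : ℂ, r ≠ 0 ∧ ∃ w : C(G, ℂ), w ≠ 0 ∧
      convolutionOperator μ κ (ContinuousMap.toLp 2 μ ℂ w) = r • w := by
  let ι : C(G, ℂ) →L[ℂ] Lp ℂ 2 μ := ContinuousMap.toLp 2 μ ℂ
  have hι : Function.Injective ι := ContinuousMap.toLp_injective μ
  let S := convolutionOperator μ κ
  have hS : IsCompactOperator S := isCompactOperator_innerOperator _
  -- Tested on the kernel k₁ at the identity: the value of `S k₁` at 1 is ‖k₁‖², which is nonzero
  -- because κ(1) ≠ 0.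
  have hT0 : ι ∘L S ≠ 0 := fun h ↦ by
    have h2 : ι (S (ι (convolutionKernel κ 1))) = 0 := by
      simpa using congrArg (fun T ↦ T (ι (convolutionKernel κ 1))) h
    have h3 : S (ι (convolutionKernel κ 1)) 1 = 0 := by
      rw [(map_eq_zero_iff ι hι).1 h2]; rfl
    have h4 : ι (convolutionKernel κ 1) = 0 := inner_self_eq_zero.1 h3
    have h5 := congrArg (fun w : C(G, ℂ) ↦ w 1) ((map_eq_zero_iff ι hι).1 h4)
    simp [hκ1] at h5
  obtain ⟨r, hr, hr0⟩ : ∃ r, Module.End.HasEigenvalue ((ι ∘L S : Lp ℂ 2 μ →L[ℂ] Lp ℂ 2 μ) :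
      Module.End ℂ (Lp ℂ 2 μ)) r ∧ r ≠ 0 := by
    by_contra! h
    exact hT0 ((ContinuousLinearMap.eq_zero_of_forall_hasEigenvalue_eq_zero (hS.clm_comp ι)
      (isSymmetric_convolutionOperator μ κ hκ)).1 h)
  obtain ⟨v, hv⟩ := hr.exists_hasEigenvector
  have hv1 : ι (S v) = r • v := hv.apply_eq_smul
  -- The L² eigenvector `v` is replaced by `S v`, which is continuous and has the same eigenvalue.
  refine ⟨r, hr0, S v, fun h ↦ ?_, ?_⟩
  · rw [h, map_zero] at hv1
    exact (smul_ne_zero hr0 hv.2) hv1.symm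
  · change S (ι (S v)) = _
    rw [hv1, map_smul]

theorem exists_character_convolutionOperator [μ.Regular] (κ : C(G, ℝ)) (hκ : ∀ x, κ x⁻¹ = κ x)
    (hκ1 : κ 1 ≠ 0) :
    ∃ r : ℂ, r ≠ 0 ∧ ∃ w : C(G, ℂ), w ≠ 0 ∧
      convolutionOperator μ κ (ContinuousMap.toLp 2 μ ℂ w) = r • w ∧
      ∃ χ : PontryaginDual G, ∀ b x, w (b * x) = χ b * w x := by
  obtain ⟨r, hr0, w₀, hw₀, hrw⟩ := exists_eigenvector_convolutionOperator μ κ hκ hκ1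
  let Q : C(G, ℂ) →L[ℂ] C(G, ℂ) := convolutionOperator μ κ ∘L ContinuousMap.toLp 2 μ ℂ
  let W := Module.End.eigenspace (Q : Module.End ℂ C(G, ℂ)) r
  have hWm : ∀ w, w ∈ W ↔ Q w = r • w := fun w ↦ Module.End.mem_eigenspace_iff
  have : FiniteDimensional ℂ W := by
    have hc' : IsCompactOperator (convolutionOperator μ κ) := isCompactOperator_innerOperator _
    exact finiteDimensional_eigenspace_of_isCompactOperator Q
      (hc'.comp_clm (ContinuousMap.toLp 2 μ ℂ)) r hr0
  have hW : W ≠ ⊥ := (Submodule.ne_bot_iff _).2 ⟨w₀, (hWm _).2 hrw, hw₀⟩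
  let L : G → Module.End ℂ C(G, ℂ) := fun b ↦
    { toFun := fun w ↦ w.comp ⟨fun x ↦ b * x, by fun_prop⟩
      map_add' := fun _ _ ↦ rfl
      map_smul' := fun _ _ ↦ rfl }
  have hLa : ∀ b w x, L b w x = w (b * x) := fun _ _ _ ↦ rfl
  obtain ⟨w, hw, hw0, c, hc⟩ := exists_common_eigenvector L
    (fun b b' ↦ LinearMap.ext fun w ↦ ContinuousMap.ext fun x ↦ by
      change w (b' * (b * x)) = w (b * (b' * x))
      rw [mul_left_comm]) W hW
    (fun b w hw ↦ by
      rw [hWm] at hw ⊢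
      refine ContinuousMap.ext fun x ↦ ?_
      refine (convolutionOperator_translate μ κ w (L b w) b x fun y ↦ hLa b w y).trans ?_
      exact congrArg (fun v : C(G, ℂ) ↦ v (b * x)) hw)
  have hcw : ∀ b x, w (b * x) = c b * w x := fun b x ↦
    congrArg (fun v : C(G, ℂ) ↦ v x) (hc b)
  obtain ⟨χ, hχ⟩ := exists_character_of_translation_eigenvector w hw0 c hcw
  exact ⟨r, hr0, w, hw0, (hWm w).1 hw, χ, fun b x ↦ by rw [hχ, hcw]⟩

set_option linter.unusedSectionVars false in
theorem integral_mul_translate_kernel (φ : C(G, ℝ)) (w : C(G, ℂ)) (a x : G)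
    (hw : ∀ y, w (a * y) = w y) :
    ∫ y, w y * ((φ (a * (x * y⁻¹)) : ℝ) : ℂ) ∂μ = ∫ y, w y * ((φ (x * y⁻¹) : ℝ) : ℂ) ∂μ := by
  rw [← integral_mul_left_eq_self (fun y ↦ w y * ((φ (a * (x * y⁻¹)) : ℝ) : ℂ)) a]
  congr 1 with y
  rw [hw, mul_inv, mul_left_comm x, mul_inv_cancel_left]

end Characters

/-- The continuous characters of a compact abelian group separate its points. -/
theorem exists_character_apply_ne_one {G : Type*} [CommGroup G] [TopologicalSpace G]
    [IsTopologicalGroup G] [CompactSpace G] [T2Space G] (a : G) (ha : a ≠ 1) :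
    ∃ χ : PontryaginDual G, χ a ≠ 1 := by
  borelize G
  obtain ⟨μ, _, _⟩ : ∃ μ : Measure G, μ.IsHaarMeasure ∧ μ.Regular :=
    ⟨Measure.haar, inferInstance, inferInstance⟩
  obtain ⟨φ₀, h0, h1, -⟩ := exists_continuous_zero_one_of_isClosed (isClosed_singleton (x := a))
    (isClosed_singleton (x := (1 : G))) (by simpa using ha)
  let φ : C(G, ℝ) := ⟨fun x ↦ φ₀ x * φ₀ x⁻¹, by fun_prop⟩
  have hφ : ∀ x, φ x⁻¹ = φ x := fun x ↦ by simp [φ, mul_comm]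
  -- This second difference of φ is even, equals 2 at the identity, and convolves to zero with every
  -- `a`-invariant function. If χ(a) = 1, the eigenvector `w` is `a`-invariant, contradicting r ≠ 0.
  obtain ⟨κ, hκφ⟩ : ∃ κ : C(G, ℝ), ∀ x, κ x = 2 * φ x - φ (a * x) - φ (a⁻¹ * x) :=
    ⟨⟨fun x ↦ 2 * φ x - φ (a * x) - φ (a⁻¹ * x), by fun_prop⟩, fun _ ↦ rfl⟩
  have hκ : ∀ x, κ x⁻¹ = κ x := fun x ↦ by
    have e1 : φ (a * x⁻¹) = φ (a⁻¹ * x) := by rw [← hφ, mul_inv, inv_inv]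
    have e2 : φ (a⁻¹ * x⁻¹) = φ (a * x) := by rw [← hφ, mul_inv, inv_inv, inv_inv]
    rw [hκφ, hκφ, hφ, e1, e2]; ring
  have hκ1 : κ 1 ≠ 0 := by
    have e0 : φ₀ a = 0 := by simpa using h0 (Set.mem_singleton a)
    have e1 : φ₀ 1 = 1 := by simpa using h1 (Set.mem_singleton 1)
    simp [hκφ, φ, e0, e1]
  obtain ⟨r, hr0, w, hw0, hrw, χ, hχ⟩ := exists_character_convolutionOperator μ κ hκ hκ1
  refine ⟨χ, fun h ↦ hw0 ?_⟩
  have hwa : ∀ x, w (a * x) = w x := fun x ↦ by rw [hχ, h, Circle.coe_one, one_mul]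
  have hwa' : ∀ x, w (a⁻¹ * x) = w x := fun x ↦ by rw [← hwa, mul_inv_cancel_left]
  have hQw : convolutionOperator μ κ (ContinuousMap.toLp 2 μ ℂ w) = 0 := by
    ext x
    rw [convolutionOperator_toLp]
    have hi : ∀ ψ : C(G, ℂ), Integrable ψ μ := fun ψ ↦
      ψ.continuous.integrable_of_hasCompactSupport (HasCompactSupport.of_compactSpace _)
    have k0 := hi ⟨fun y ↦ w y * ((φ (x * y⁻¹) : ℝ) : ℂ), by fun_prop⟩
    have k1 := hi ⟨fun y ↦ w y * ((φ (a * (x * y⁻¹)) : ℝ) : ℂ), by fun_prop⟩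
    have k2 := hi ⟨fun y ↦ w y * ((φ (a⁻¹ * (x * y⁻¹)) : ℝ) : ℂ), by fun_prop⟩
    simp only [ContinuousMap.coe_mk] at k0 k1 k2
    have k01 : Integrable (fun y ↦ 2 * (w y * ((φ (x * y⁻¹) : ℝ) : ℂ)) -
      w y * ((φ (a * (x * y⁻¹)) : ℝ) : ℂ)) μ := (k0.const_mul 2).sub k1
    calc ∫ y, w y * ((κ (x * y⁻¹) : ℝ) : ℂ) ∂μ
        = ∫ y, (2 * (w y * ((φ (x * y⁻¹) : ℝ) : ℂ)) - w y * ((φ (a * (x * y⁻¹)) : ℝ) : ℂ)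
            - w y * ((φ (a⁻¹ * (x * y⁻¹)) : ℝ) : ℂ)) ∂μ := by
          congr 1 with y
          rw [hκφ]
          push_cast
          ring
      _ = 0 := by
          rw [integral_sub k01 k2, integral_sub (k0.const_mul 2) k1,
            integral_const_mul, integral_mul_translate_kernel μ φ w a x hwa,
            integral_mul_translate_kernel μ φ w a⁻¹ x hwa']
          ring
  rw [hQw] at hrw
  exact (smul_eq_zero.1 hrw.symm).resolve_left hr0

/-! ### Uniqueness of Fourier coefficients. -/

/-- A function orthogonal to all continuous characters is orthogonal to all continuous
functions. -/
theorem integral_mul_eq_zero_of_fourierCoefficient_eq_zero {G : Type*} [CommGroup G]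
    [TopologicalSpace G] [IsTopologicalGroup G] [CompactSpace G] [T2Space G] [MeasurableSpace G]
    [BorelSpace G] (μ : Measure G) (g : G → ℂ) (hg : Integrable g μ)
    (h : ∀ χ : PontryaginDual G, fourierCoefficient μ g χ = 0) (φ : C(G, ℂ)) :
    ∫ x, g x * φ x ∂μ = 0 := by
  let e : PontryaginDual G → C(G, ℂ) := fun χ ↦ ⟨fun x ↦ χ x, by fun_prop⟩
  have he : ∀ χ x, e χ x = χ x := fun _ _ ↦ rfl
  have hmul : ∀ χ χ', e χ * e χ' = e (χ * χ') := fun χ χ' ↦ by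
    ext x
    change (χ x : ℂ) * χ' x = ((χ x * χ' x : Circle) : ℂ)
    simp
  have hstar : ∀ χ, star (e χ) = e χ⁻¹ := fun χ ↦ by
    ext x
    change conj (χ x : ℂ) = (((χ x)⁻¹ : Circle) : ℂ)
    rw [Circle.coe_inv_eq_conj]
  -- Stone–Weierstrass: the span of the characters is closed under products and conjugation, and it
  -- separates points.
  let A : StarSubalgebra ℂ C(G, ℂ) :=
    { (Submodule.span ℂ (Set.range e)).toSubalgebra
        (Submodule.subset_span ⟨1, by ext x; simp [e]⟩)
        (fun a b ha hb ↦ by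
          have := Submodule.mul_mem_mul ha hb
          rw [Submodule.span_mul_span] at this
          refine Submodule.span_mono ?_ this
          rintro _ ⟨_, ⟨χ, rfl⟩, _, ⟨χ', rfl⟩, rfl⟩
          exact ⟨χ * χ', (hmul χ χ').symm⟩) with
      star_mem' := fun {a} ha ↦ by
        change a ∈ Submodule.span ℂ (Set.range e) at ha
        change star a ∈ Submodule.span ℂ (Set.range e)
        induction ha using Submodule.span_induction with
        | mem x hx =>
          obtain ⟨χ, rfl⟩ := hx
          rw [hstar]
          exact Submodule.subset_span ⟨_, rfl⟩
        | zero => simp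
        | add x y _ _ hx hy => rw [star_add]; exact add_mem hx hy
        | smul c x _ hx => rw [star_smul]; exact Submodule.smul_mem _ _ hx }
  have hA : ∀ x, x ∈ A ↔ x ∈ Submodule.span ℂ (Set.range e) := fun _ ↦ Iff.rfl
  have hsep : A.SeparatesPoints := fun x y hxy ↦ by
    obtain ⟨χ, hχ⟩ := exists_character_apply_ne_one (x * y⁻¹) (by
      rwa [Ne, mul_inv_eq_one])
    refine ⟨_, ⟨e χ, (hA _).2 (Submodule.subset_span ⟨χ, rfl⟩), rfl⟩, fun hc ↦ hχ ?_⟩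
    rw [map_mul, map_inv, mul_inv_eq_one]
    exact Subtype.ext hc
  have htop := ContinuousMap.starSubalgebra_topologicalClosure_eq_top_of_separatesPoints A hsep
  have hi : ∀ φ : C(G, ℂ), Integrable (fun x ↦ g x * φ x) μ := fun φ ↦
    hg.mul_bdd (c := ‖φ‖) φ.continuous.aestronglyMeasurable (ae_of_all _ φ.norm_coe_le_norm)
  let ℓ : C(G, ℂ) →L[ℂ] ℂ := LinearMap.mkContinuous
    { toFun := fun φ ↦ ∫ x, g x * φ x ∂μ
      map_add' := fun φ ψ ↦ by
        simp only [ContinuousMap.add_apply, mul_add]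
        exact integral_add (hi φ) (hi ψ)
      map_smul' := fun c φ ↦ by
        simp only [ContinuousMap.smul_apply, smul_eq_mul, RingHom.id_apply,
          ← integral_const_mul]
        congr 1 with x; ring } (∫ x, ‖g x‖ ∂μ) fun φ ↦ by
      refine (norm_integral_le_integral_norm _).trans ?_
      rw [← integral_mul_const]
      refine integral_mono (hi φ).norm (hg.norm.mul_const _) fun x ↦ ?_
      simp only [norm_mul]
      gcongr
      exact φ.norm_coe_le_norm x
  have hℓ : ∀ φ, ℓ φ = ∫ x, g x * φ x ∂μ := fun _ ↦ rfl
  have hspan : ∀ φ ∈ A, ℓ φ = 0 := fun φ hφ ↦ by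
    rw [hA] at hφ
    induction hφ using Submodule.span_induction with
    | mem x hx =>
      obtain ⟨χ, rfl⟩ := hx
      rw [hℓ, ← h χ⁻¹, fourierCoefficient]
      congr 1 with x
      rw [he]
      congr 1
      change _ = conj (((χ x)⁻¹ : Circle) : ℂ)
      rw [Circle.coe_inv_eq_conj, Complex.conj_conj]
    | zero => simp
    | add x y _ _ hx hy => rw [map_add, hx, hy, add_zero]
    | smul c x _ hx => rw [map_smul, hx, smul_zero]
  have hφ : φ ∈ closure (A : Set C(G, ℂ)) := by
    have : φ ∈ A.topologicalClosure := htop ▸ StarSubalgebra.mem_top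
    exact this
  rw [← hℓ]
  exact closure_minimal (t := {φ | ℓ φ = 0}) hspan (isClosed_eq ℓ.continuous continuous_const) hφ

/-- An integrable function orthogonal to all continuous functions vanishes almost everywhere. -/
theorem ae_eq_zero_of_integral_mul_continuous_eq_zero {X : Type*} [TopologicalSpace X]
    [CompactSpace X] [T2Space X] [MeasurableSpace X] [BorelSpace X] (μ : Measure X) [μ.Regular]
    (g : X → ℂ) (hg : Integrable g μ) (h : ∀ φ : C(X, ℂ), ∫ x, g x * φ x ∂μ = 0) :
    g =ᵐ[μ] 0 := by
  refine ae_eq_zero_of_forall_setIntegral_isCompact_eq_zero hg fun K hK ↦ ?_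
  rw [← norm_le_zero_iff]
  refine le_of_forall_pos_le_add fun ε hε ↦ ?_
  -- Urysohn's φ is 1 on `K` and 0 off an open `U` close to `K`. Since ∫ gφ = 0, ∫_K g equals the
  -- integral of 1_K g - gφ, which lives on `U \ K` and is small by absolute continuity.
  obtain ⟨η, hη, hs⟩ := exists_pos_setLIntegral_lt_of_measure_lt hg.2.ne
    (ENNReal.ofReal_pos.2 hε).ne'
  obtain ⟨U, hKU, hU, hUη⟩ := hK.exists_isOpen_lt_add (μ := μ) hη.ne'
  obtain ⟨φ, hφ0, hφ1, hφ⟩ := exists_continuous_zero_one_of_isClosed hU.isClosed_compl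
    hK.isClosed (Set.disjoint_compl_left_iff_subset.2 hKU)
  have hUK : μ (U \ K) < η := by
    rw [measure_sdiff hKU hK.measurableSet.nullMeasurableSet hK.measure_lt_top.ne]
    exact ENNReal.sub_lt_of_lt_add (measure_mono hKU) (by rwa [add_comm])
  have hmK := hK.measurableSet
  have hm : MeasurableSet (U \ K) := hU.measurableSet.diff hmK
  have hi : Integrable (fun x ↦ g x * (φ x : ℂ)) μ := by
    refine hg.mul_bdd (c := 1) (by fun_prop) (ae_of_all _ fun x ↦ ?_)
    simpa [abs_of_nonneg (hφ x).1] using (hφ x).2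
  have h1 : ∫ x, K.indicator g x ∂μ = ∫ x, (K.indicator g x - g x * (φ x : ℂ)) ∂μ := by
    rw [integral_sub (hg.indicator hmK) hi]
    have h0 := h ⟨fun x ↦ (φ x : ℂ), by fun_prop⟩
    simp only [ContinuousMap.coe_mk] at h0
    rw [h0, sub_zero]
  rw [← integral_indicator hmK, h1, zero_add]
  refine (norm_integral_le_lintegral_norm _).trans ?_
  refine ENNReal.toReal_le_of_le_ofReal hε.le (le_trans ?_ (hs _ hUK).le)
  rw [← lintegral_indicator hm]
  refine lintegral_mono fun x ↦ ?_
  by_cases hxK : x ∈ K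
  · have : φ x = 1 := hφ1 hxK
    simp [hxK, this]
  by_cases hxU : x ∈ U
  · have hx : x ∈ U \ K := ⟨hxU, hxK⟩
    simp only [Set.indicator_of_notMem hxK, Set.indicator_of_mem hx, zero_sub, norm_neg,
      ofReal_norm, enorm_mul]
    refine (mul_le_mul_right (b := ‖(φ x : ℂ)‖ₑ) (c := 1) ?_ _).trans_eq (mul_one _)
    rw [← ofReal_norm, ENNReal.ofReal_le_one]
    simpa [abs_of_nonneg (hφ x).1] using (hφ x).2
  · have : φ x = 0 := hφ0 hxU
    simp [hxK, hxU, this]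

theorem norm_character {G : Type*} [CommGroup G] [TopologicalSpace G] (χ : PontryaginDual G)
    (x : G) : ‖(χ x : ℂ)‖ = 1 :=
  Circle.norm_coe _

theorem integrable_mul_conj_character {G : Type*} [CommGroup G] [TopologicalSpace G]
    [MeasurableSpace G] [BorelSpace G] (μ : Measure G) {f : G → ℂ} (hf : Integrable f μ)
    (χ : PontryaginDual G) : Integrable (fun x ↦ f x * conj (χ x : ℂ)) μ :=
  hf.mul_bdd (c := 1) (by fun_prop) (ae_of_all _ fun x ↦ by
    rw [RCLike.norm_conj, norm_character])

/-- Uniqueness of Fourier coefficients on compact abelian groups. -/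
theorem ae_eq_of_fourierCoefficient_eq {G : Type*} [CommGroup G]
    [TopologicalSpace G] [IsTopologicalGroup G] [CompactSpace G] [T2Space G] [MeasurableSpace G]
    [BorelSpace G] (μ : Measure G) [μ.Regular] (f g : G → ℂ) (hf : Integrable f μ)
    (hg : Integrable g μ)
    (h : ∀ χ : PontryaginDual G, fourierCoefficient μ f χ = fourierCoefficient μ g χ) :
    f =ᵐ[μ] g := by
  have h1 : ∀ χ : PontryaginDual G, fourierCoefficient μ (f - g) χ = 0 := fun χ ↦ by
    have hb : ∀ u : G → ℂ, Integrable u μ → Integrable (fun x ↦ u x * conj (χ x : ℂ)) μ :=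
      fun u hu ↦ integrable_mul_conj_character μ hu χ
    have h2 := h χ
    simp only [fourierCoefficient, Pi.sub_apply, sub_mul] at h2 ⊢
    rw [integral_sub (hb f hf) (hb g hg), h2, sub_self]
  have h2 := ae_eq_zero_of_integral_mul_continuous_eq_zero μ (f - g) (hf.sub hg)
    (integral_mul_eq_zero_of_fourierCoefficient_eq_zero μ _ (hf.sub hg) h1)
  filter_upwards [h2] with x hx
  exact sub_eq_zero.1 hx

/-! ### De la Vallée-Poussin kernels on the line. -/

section Kernel

theorem integrable_one_sub_cos_div_sq (x : ℝ) :
    Integrable (fun t : ℝ ↦ (1 - Real.cos (x * t)) / t ^ 2) := by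
  -- The constant adds two bounds for 1 - cos(xt): x²t²/2, used near 0, and 2, used at infinity.
  refine (integrable_inv_one_add_sq.const_mul (x ^ 2 / 2 + 2)).mono'
    (Measurable.aestronglyMeasurable (by fun_prop))
    (ae_of_all _ fun t ↦ ?_)
  have h1 : 0 ≤ 1 - Real.cos (x * t) := by linarith [Real.cos_le_one (x * t)]
  rw [Real.norm_of_nonneg (by positivity), ← div_eq_mul_inv]
  rcases eq_or_ne t 0 with rfl | ht
  · simp only [mul_zero, Real.cos_zero, sub_self, zero_div]; positivity
  have h2 : 1 - Real.cos (x * t) ≤ (x * t) ^ 2 / 2 := by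
    linarith [Real.one_sub_sq_div_two_le_cos (x := x * t)]
  have h3 := Real.neg_one_le_cos (x * t)
  rw [div_le_div_iff₀ (by positivity) (by positivity)]
  nlinarith [sq_nonneg t]

/-- The normalising constant `∫ (1 - cos t) / t²` (which equals `π`). -/
noncomputable def fejerConst : ℝ := ∫ t : ℝ, (1 - Real.cos t) / t ^ 2

theorem fejerConst_pos : 0 < fejerConst := by
  have hi := integrable_one_sub_cos_div_sq 1
  simp only [one_mul] at hi
  have h0 : 0 ≤ fun t : ℝ ↦ (1 - Real.cos t) / t ^ 2 := fun t ↦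
    div_nonneg (by linarith [Real.cos_le_one t]) (sq_nonneg t)
  rw [fejerConst, integral_pos_iff_support_of_nonneg h0 hi]
  refine lt_of_lt_of_le ?_ (measure_mono (s := Set.Ioo 0 1) fun t ht ↦ ?_)
  · simp
  · have h1 : Real.cos t < 1 := by
      rw [← Real.cos_zero]
      exact Real.cos_lt_cos_of_nonneg_of_le_pi le_rfl (by linarith [ht.2, Real.pi_gt_three]) ht.1
    exact (div_pos (by linarith) (pow_pos ht.1 2)).ne'

theorem integral_one_sub_cos_div_sq (x : ℝ) :
    ∫ t : ℝ, (1 - Real.cos (x * t)) / t ^ 2 = fejerConst * |x| := by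
  rcases eq_or_ne x 0 with rfl | hx
  · simp
  have h := Measure.integral_comp_mul_left (fun t : ℝ ↦ (1 - Real.cos t) / t ^ 2) x
  have h2 : ∀ t : ℝ, (1 - Real.cos (x * t)) / t ^ 2 =
      x ^ 2 * ((1 - Real.cos (x * t)) / (x * t) ^ 2) := fun t ↦ by
    rw [mul_pow, mul_div_assoc', mul_div_mul_left _ _ (pow_ne_zero 2 hx)]
  simp_rw [h2]
  rw [integral_const_mul, h, smul_eq_mul, fejerConst, abs_inv, ← sq_abs x]
  have : |x| ≠ 0 := abs_ne_zero.2 hx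
  field_simp

/-- The de la Vallée-Poussin kernel, whose Fourier transform is the trapezoid function equal to
`1` on `[-A, A]` and to `0` outside `[-B, B]`. -/
noncomputable def trapezoidKernel (A B t : ℝ) : ℝ :=
  (Real.cos (A * t) - Real.cos (B * t)) / t ^ 2 / (fejerConst * (B - A))

/-- The Fourier transform of `trapezoidKernel`. -/
noncomputable def trapezoid (A B x : ℝ) : ℝ :=
  (|B + x| + |B - x| - |A + x| - |A - x|) / (2 * (B - A))

theorem trapezoid_eq_one {A B x : ℝ} (hAB : A < B) (hx : 0 ≤ x) (hxA : x ≤ A) :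
    trapezoid A B x = 1 := by
  rw [trapezoid, abs_of_nonneg (by linarith), abs_of_nonneg (by linarith),
    abs_of_nonneg (by linarith), abs_of_nonneg (by linarith), div_eq_one_iff_eq (by linarith)]
  ring

theorem trapezoid_eq_zero {A B x : ℝ} (hA : 0 ≤ A) (hAB : A < B) (hx : B ≤ x) :
    trapezoid A B x = 0 := by
  rw [trapezoid, abs_of_nonneg (by linarith), abs_of_nonpos (by linarith),
    abs_of_nonneg (by linarith), abs_of_nonpos (by linarith)]
  ring

/-- The reverse triangle inequality bounds each of |B ± x| - |A ± x| by B - A. -/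
theorem abs_trapezoid_le_one {A B : ℝ} (hAB : A < B) (x : ℝ) :
    |trapezoid A B x| ≤ 1 := by
  rw [trapezoid, abs_div, abs_of_pos (by linarith : 0 < 2 * (B - A)), div_le_one (by linarith)]
  have h1 := abs_abs_sub_abs_le_abs_sub (B + x) (A + x)
  have h2 := abs_abs_sub_abs_le_abs_sub (B - x) (A - x)
  have h3 : |B - A| = B - A := abs_of_pos (by linarith)
  rw [show B + x - (A + x) = B - A by ring, h3] at h1
  rw [show B - x - (A - x) = B - A by ring, h3] at h2
  rw [abs_le] at h1 h2 ⊢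
  constructor <;> linarith [h1.1, h1.2, h2.1, h2.2]

theorem trapezoidKernel_neg (A B t : ℝ) : trapezoidKernel A B (-t) = trapezoidKernel A B t := by
  simp [trapezoidKernel]

theorem integrable_trapezoidKernel (A B : ℝ) : Integrable (trapezoidKernel A B) := by
  have h := ((integrable_one_sub_cos_div_sq B).sub (integrable_one_sub_cos_div_sq A)).div_const
    (fejerConst * (B - A))
  refine h.congr (ae_of_all _ fun t ↦ ?_)
  simp only [trapezoidKernel, Pi.sub_apply]
  ring

/-- Product-to-sum formulas reduce this to four integrals ∫ (1 - cos(yt))/t² with y = B ± x, A ± x;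
these give the four absolute values. -/
theorem integral_trapezoidKernel_mul_cos (A B x : ℝ) :
    ∫ t, trapezoidKernel A B t * Real.cos (x * t) = trapezoid A B x := by
  have h : ∀ y, Integrable (fun t : ℝ ↦ (1 - Real.cos (y * t)) / t ^ 2) :=
    integrable_one_sub_cos_div_sq
  have e : ∀ t, trapezoidKernel A B t * Real.cos (x * t) =
      ((1 - Real.cos ((B + x) * t)) / t ^ 2 + (1 - Real.cos ((B - x) * t)) / t ^ 2
        - (1 - Real.cos ((A + x) * t)) / t ^ 2 - (1 - Real.cos ((A - x) * t)) / t ^ 2)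
        / (2 * (fejerConst * (B - A))) := fun t ↦ by
    simp only [trapezoidKernel]
    generalize fejerConst * (B - A) = D
    simp only [add_mul, sub_mul, Real.cos_add, Real.cos_sub]
    ring
  have i1 : Integrable fun t : ℝ ↦
      (1 - Real.cos ((B + x) * t)) / t ^ 2 + (1 - Real.cos ((B - x) * t)) / t ^ 2 :=
    (h _).add (h _)
  have i2 : Integrable fun t : ℝ ↦
      (1 - Real.cos ((B + x) * t)) / t ^ 2 + (1 - Real.cos ((B - x) * t)) / t ^ 2
        - (1 - Real.cos ((A + x) * t)) / t ^ 2 := i1.sub (h _)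
  simp_rw [e]
  rw [integral_div, integral_sub i2 (h _), integral_sub i1 (h _), integral_add (h _) (h _)]
  simp only [integral_one_sub_cos_div_sq, trapezoid]
  rw [← mul_add, ← mul_sub, ← mul_sub, mul_left_comm 2, mul_div_mul_left _ _ fejerConst_pos.ne']

theorem integral_trapezoidKernel_mul_exp (A B x : ℝ) :
    ∫ t, (trapezoidKernel A B t : ℂ) * Complex.exp (-(Complex.I * (x : ℂ) * (t : ℂ))) =
      trapezoid A B x := by
  have hc : Integrable fun t ↦ trapezoidKernel A B t * Real.cos (x * t) :=
    (integrable_trapezoidKernel A B).mul_bdd (c := 1) (by fun_prop)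
      (ae_of_all _ fun t ↦ Real.abs_cos_le_one _)
  have hs : Integrable fun t ↦ trapezoidKernel A B t * Real.sin (x * t) :=
    (integrable_trapezoidKernel A B).mul_bdd (c := 1) (by fun_prop)
      (ae_of_all _ fun t ↦ Real.abs_sin_le_one _)
  have hs0 : ∫ t, trapezoidKernel A B t * Real.sin (x * t) = 0 := by
    have h := integral_neg_eq_self (fun t ↦ trapezoidKernel A B t * Real.sin (x * t)) volume
    simp only [trapezoidKernel_neg, mul_neg, Real.sin_neg] at h
    rw [integral_neg] at h
    linarith
  have e : ∀ t : ℝ, (trapezoidKernel A B t : ℂ) * Complex.exp (-(Complex.I * (x : ℂ) * (t : ℂ))) =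
      ((trapezoidKernel A B t * Real.cos (x * t) : ℝ) : ℂ) -
        ((trapezoidKernel A B t * Real.sin (x * t) : ℝ) : ℂ) * Complex.I := fun t ↦ by
    rw [show -(Complex.I * (x : ℂ) * (t : ℂ)) = ((-(x * t) : ℝ) : ℂ) * Complex.I by
      push_cast; ring, Complex.exp_mul_I, ← Complex.ofReal_cos, ← Complex.ofReal_sin,
      Real.cos_neg, Real.sin_neg]
    push_cast
    ring
  simp_rw [e]
  rw [integral_sub hc.ofReal (hs.ofReal.mul_const _), integral_mul_const, integral_complex_ofReal,
    integral_complex_ofReal, integral_trapezoidKernel_mul_cos, hs0]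
  simp

/-- A majorant of the kernels `trapezoidKernel A B` with `B ≤ M` and `d ≤ B - A`. -/
noncomputable def kernelMajorant (M d t : ℝ) : ℝ := min M (min (1 / |t|) (2 / (d * t ^ 2)))

/-- Write cos At - cos Bt = 2 sin((B+A)t/2) sin((B-A)t/2). Using |sin u| ≤ |u| in both factors gives
M, in the second only gives 1/|t|, and the trivial bound 2 on the difference gives the last term. -/
theorem abs_trapezoidKernel_le {A B M d t : ℝ} (hA : 0 ≤ A) (hBM : B ≤ M) (hd : 0 < d)
    (hdB : d ≤ B - A) (ht : t ≠ 0) :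
    |trapezoidKernel A B t| ≤ kernelMajorant M d t / fejerConst := by
  have hBA : 0 < B - A := hd.trans_le hdB
  have hc := fejerConst_pos
  rw [trapezoidKernel, abs_div, abs_of_pos (mul_pos hc hBA), mul_comm fejerConst, ← div_div]
  refine div_le_div_of_nonneg_right ?_ hc.le
  have ht2 : 0 < t ^ 2 := by positivity
  have hAB : 0 ≤ (B + A) / 2 := by linarith
  rw [abs_div, abs_of_pos ht2, div_div]
  have e : Real.cos (A * t) - Real.cos (B * t) =
      2 * Real.sin ((B + A) / 2 * t) * Real.sin ((B - A) / 2 * t) := by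
    rw [Real.cos_sub_cos, show (A * t - B * t) / 2 = -((B - A) / 2 * t) by ring, Real.sin_neg,
      show (A * t + B * t) / 2 = (B + A) / 2 * t by ring]
    ring
  have s1 : |Real.sin ((B - A) / 2 * t)| ≤ (B - A) / 2 * |t| := by
    refine Real.abs_sin_le_abs.trans_eq ?_
    rw [abs_mul, abs_of_pos (by linarith)]
  have s2 : |Real.sin ((B + A) / 2 * t)| ≤ (B + A) / 2 * |t| := by
    refine Real.abs_sin_le_abs.trans_eq ?_
    rw [abs_mul, abs_of_pos (by linarith)]
  have e' : |Real.cos (A * t) - Real.cos (B * t)| =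
      2 * |Real.sin ((B + A) / 2 * t)| * |Real.sin ((B - A) / 2 * t)| := by
    rw [e, abs_mul, abs_mul, abs_two]
  refine le_min ?_ (le_min ?_ ?_)
  · rw [div_le_iff₀ (by positivity), e']
    calc 2 * |Real.sin ((B + A) / 2 * t)| * |Real.sin ((B - A) / 2 * t)|
        ≤ 2 * ((B + A) / 2 * |t|) * ((B - A) / 2 * |t|) := by
          gcongr
      _ = (B + A) / 2 * (t ^ 2 * (B - A)) := by rw [← sq_abs t]; ring
      _ ≤ M * (t ^ 2 * (B - A)) := by gcongr; linarith
  · rw [div_le_iff₀ (by positivity), e', ← sq_abs t]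
    have : 0 < |t| := abs_pos.2 ht
    calc 2 * |Real.sin ((B + A) / 2 * t)| * |Real.sin ((B - A) / 2 * t)|
        ≤ 2 * 1 * ((B - A) / 2 * |t|) := by
          gcongr; exact Real.abs_sin_le_one _
      _ = 1 / |t| * (|t| ^ 2 * (B - A)) := by field_simp
  · rw [mul_comm (t ^ 2)]
    refine div_le_div₀ (by norm_num) ?_ (by positivity) (by gcongr)
    rw [abs_le]
    constructor <;> linarith [Real.cos_le_one (A * t), Real.neg_one_le_cos (A * t),
      Real.cos_le_one (B * t), Real.neg_one_le_cos (B * t)]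

theorem measurable_kernelMajorant (M d : ℝ) : Measurable (kernelMajorant M d) := by
  unfold kernelMajorant; fun_prop

theorem kernelMajorant_abs (M d t : ℝ) : kernelMajorant M d |t| = kernelMajorant M d t := by
  simp [kernelMajorant]

theorem lintegral_even {φ : ℝ → ℝ≥0∞} (hφ : ∀ t, φ (-t) = φ t) :
    ∫⁻ t, φ t = 2 * ∫⁻ t in Set.Ioi 0, φ t := by
  rw [← lintegral_add_compl φ (measurableSet_Ioi (a := (0 : ℝ))), Set.compl_Ioi, two_mul]
  congr 1
  rw [← setLIntegral_congr (Iio_ae_eq_Iic (a := (0 : ℝ)) (μ := volume))]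
  have h := (Measure.measurePreserving_neg (volume : Measure ℝ)).setLIntegral_comp_preimage_emb
    (MeasurableEquiv.neg ℝ).measurableEmbedding φ (Set.Ioi 0)
  simp only [hφ] at h
  rw [← h]
  congr 2
  ext t
  simp

/-- On (0, 1/M], (1/M, 1/d] and (1/d, ∞) the three terms of the minimum contribute 1, log(M/d) and
2. -/
theorem lintegral_kernelMajorant_le {M d : ℝ} (hd : 0 < d) (hdM : d ≤ M) :
    ∫⁻ t, ENNReal.ofReal (kernelMajorant M d t) ≤ ENNReal.ofReal (2 * (3 + Real.log (M / d))) := by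
  have hM : 0 < M := hd.trans_le hdM
  have hinv : 1 / M ≤ 1 / d := one_div_le_one_div_of_le hd hdM
  have hM' : 0 < 1 / M := by positivity
  have hd' : 0 < 1 / d := by positivity
  have hlog : 0 ≤ Real.log (M / d) := Real.log_nonneg ((one_le_div hd).2 hdM)
  rw [lintegral_even fun t ↦ by rw [← kernelMajorant_abs, abs_neg, kernelMajorant_abs],
    ENNReal.ofReal_mul (by norm_num), ENNReal.ofReal_ofNat]
  gcongr
  rw [← Set.Ioc_union_Ioi_eq_Ioi hM'.le, ← Set.Ioc_union_Ioi_eq_Ioi hinv]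
  refine (lintegral_union_le _ _ _).trans ?_
  refine (add_le_add_right (lintegral_union_le _ _ _) _).trans ?_
  have h1 : ∫⁻ t in Set.Ioc 0 (1 / M), ENNReal.ofReal (kernelMajorant M d t) ≤
      ENNReal.ofReal 1 := by
    calc _ ≤ ∫⁻ _ in Set.Ioc 0 (1 / M), ENNReal.ofReal M :=
          lintegral_mono fun t ↦ ENNReal.ofReal_le_ofReal (min_le_left _ _)
      _ = ENNReal.ofReal 1 := by
          rw [setLIntegral_const, Real.volume_Ioc, ← ENNReal.ofReal_mul hM.le]
          congr 1
          field_simp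
          ring
  have h2 : ∫⁻ t in Set.Ioc (1 / M) (1 / d), ENNReal.ofReal (kernelMajorant M d t) ≤
      ENNReal.ofReal (Real.log (M / d)) := by
    have hi : IntervalIntegrable (fun t : ℝ ↦ t⁻¹) volume (1 / M) (1 / d) :=
      intervalIntegral.intervalIntegrable_inv
        (fun t ht ↦ by
          rw [Set.uIcc_of_le hinv] at ht
          exact (hM'.trans_le ht.1).ne') continuousOn_id
    have hv : ∫ t in Set.Ioc (1 / M) (1 / d), t⁻¹ = Real.log (M / d) := by
      rw [← intervalIntegral.integral_of_le hinv, integral_inv_of_pos hM' hd']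
      congr 1
      field_simp
    rw [← hv, ofReal_integral_eq_lintegral_ofReal
      ((intervalIntegrable_iff_integrableOn_Ioc_of_le hinv).1 hi)]
    · refine setLIntegral_mono (by fun_prop) fun t ht ↦ ENNReal.ofReal_le_ofReal ?_
      refine (min_le_right _ _).trans ((min_le_left _ _).trans_eq ?_)
      rw [abs_of_pos (hM'.trans ht.1), one_div]
    · refine (ae_restrict_iff' measurableSet_Ioc).2 (ae_of_all _ fun t ht ↦ ?_)
      exact inv_nonneg.2 (hM'.trans ht.1).le
  have h3 : ∫⁻ t in Set.Ioi (1 / d), ENNReal.ofReal (kernelMajorant M d t) ≤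
      ENNReal.ofReal 2 := by
    have hi : IntegrableOn (fun t : ℝ ↦ 2 / d * t ^ (-2 : ℝ)) (Set.Ioi (1 / d)) :=
      (integrableOn_Ioi_rpow_of_lt (by norm_num) hd').const_mul _
    have hv : ∫ t in Set.Ioi (1 / d), 2 / d * t ^ (-2 : ℝ) = 2 := by
      rw [integral_const_mul, integral_Ioi_rpow_of_lt (by norm_num) hd',
        show (-2 : ℝ) + 1 = -1 by norm_num, Real.rpow_neg_one]
      field_simp
    rw [← hv, ofReal_integral_eq_lintegral_ofReal hi]
    · refine setLIntegral_mono (by fun_prop) fun t ht ↦ ENNReal.ofReal_le_ofReal ?_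
      refine (min_le_right _ _).trans ((min_le_right _ _).trans_eq ?_)
      rw [Real.rpow_neg (hd'.trans ht).le, Real.rpow_two]
      field_simp
    · refine (ae_restrict_iff' measurableSet_Ioi).2 (ae_of_all _ fun t ht ↦ ?_)
      have : (0 : ℝ) < t := hd'.trans ht
      exact mul_nonneg (by positivity) (Real.rpow_nonneg this.le _)
  refine (add_le_add h1 (add_le_add h2 h3)).trans_eq ?_
  rw [← ENNReal.ofReal_add hlog (by norm_num), ← ENNReal.ofReal_add (by norm_num) (by positivity)]
  congr 1
  ring

end Kernel

/-! ### Averages along a path in the group. -/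

/-- Minkowski's inequality for averages of measure-preserving transformations. -/
theorem eLpNorm_lintegral_comp_le {X T : Type*} [MeasurableSpace X] [MeasurableSpace T]
    (μ : Measure X) [SFinite μ] (ν : Measure T) [IsFiniteMeasure ν] (τ : X → T → X)
    (hτ : Measurable (Function.uncurry τ)) (hτμ : ∀ t, MeasurePreserving (fun x ↦ τ x t) μ μ)
    (g : X → ℝ≥0∞) (hg : Measurable g) (p : ℝ≥0∞) (hp : 1 ≤ p) :
    eLpNorm (fun x ↦ ∫⁻ t, g (τ x t) ∂ν) p μ ≤ ν Set.univ * eLpNorm g p μ := by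
  have hgτ : Measurable (fun z : X × T ↦ g (τ z.1 z.2)) := hg.comp hτ
  rcases eq_or_ne p ∞ with rfl | hpt
  · rw [eLpNorm_exponent_top, eLpNorm_exponent_top]
    have h1 : ∀ t, ∀ᵐ x ∂μ, g (τ x t) ≤ eLpNormEssSup g μ := fun t ↦
      (hτμ t).quasiMeasurePreserving.ae (ae_le_eLpNormEssSup (f := g))
    have hms : MeasurableSet {z : X × T | g (τ z.1 z.2) ≤ eLpNormEssSup g μ} :=
      measurableSet_le hgτ measurable_const
    have h2 : ∀ᵐ x ∂μ, ∀ᵐ t ∂ν, g (τ x t) ≤ eLpNormEssSup g μ :=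
      (Measure.ae_ae_comm hms).2 (ae_of_all _ h1)
    refine eLpNormEssSup_le_of_ae_enorm_bound ?_
    filter_upwards [h2] with x hx
    refine (lintegral_mono_ae hx).trans_eq ?_
    rw [lintegral_const, mul_comm]
  have hp0 : p ≠ 0 := (one_pos.trans_le hp).ne'
  have hq1 : 1 ≤ p.toReal := by
    rw [← ENNReal.toReal_one]; exact ENNReal.toReal_mono hpt hp
  have hq0 : 0 < p.toReal := one_pos.trans_le hq1
  rw [eLpNorm_eq_lintegral_rpow_enorm_toReal hp0 hpt, eLpNorm_eq_lintegral_rpow_enorm_toReal hp0 hpt]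
  simp only [enorm_eq_self]
  set q := p.toReal
  -- Hölder in `t` against the finite measure ν; Tonelli and measure preservation then finish the
  -- case p < ∞.
  have hJ : ∀ x, (∫⁻ t, g (τ x t) ∂ν) ^ q ≤
      ν Set.univ ^ (q - 1) * ∫⁻ t, g (τ x t) ^ q ∂ν := fun x ↦ by
    have h := eLpNorm'_le_eLpNorm'_mul_rpow_measure_univ (μ := ν) (f := fun t ↦ g (τ x t))
      one_pos hq1 (hgτ.comp measurable_prodMk_left).aestronglyMeasurable
    simp only [eLpNorm', enorm_eq_self, ENNReal.rpow_one, div_one] at h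
    have h' := ENNReal.rpow_le_rpow h hq0.le
    rw [ENNReal.mul_rpow_of_nonneg _ _ hq0.le, ← ENNReal.rpow_mul, ← ENNReal.rpow_mul,
      one_div_mul_cancel hq0.ne', ENNReal.rpow_one, sub_mul, one_div_mul_cancel hq0.ne',
      one_mul, mul_comm] at h'
    exact h'
  calc (∫⁻ x, (∫⁻ t, g (τ x t) ∂ν) ^ q ∂μ) ^ (1 / q)
      ≤ (∫⁻ x, ν Set.univ ^ (q - 1) * ∫⁻ t, g (τ x t) ^ q ∂ν ∂μ) ^ (1 / q) := by
        gcongr with x; exact hJ x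
    _ = (ν Set.univ ^ (q - 1) * (ν Set.univ * ∫⁻ x, g x ^ q ∂μ)) ^ (1 / q) := by
        rw [lintegral_const_mul _ (hgτ.pow_const q).lintegral_prod_right',
          lintegral_lintegral_swap (hgτ.pow_const q).aemeasurable]
        simp_rw [(hτμ _).lintegral_comp (hg.pow_const q)]
        rw [lintegral_const, mul_comm (ν Set.univ) (lintegral _ _)]
    _ = ν Set.univ * (∫⁻ x, g x ^ q ∂μ) ^ (1 / q) := by
        rw [← mul_assoc]
        have : ν Set.univ ^ (q - 1) * ν Set.univ = ν Set.univ ^ q := by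
          nth_rewrite 2 [← ENNReal.rpow_one (ν Set.univ)]
          rw [← ENNReal.rpow_add_of_nonneg _ _ (by linarith) zero_le_one, sub_add_cancel]
        rw [this, ENNReal.mul_rpow_of_nonneg _ _ (by positivity), ← ENNReal.rpow_mul,
          mul_one_div_cancel hq0.ne', ENNReal.rpow_one]

section Convolution

variable {G : Type*} [CommGroup G] [TopologicalSpace G] [IsTopologicalGroup G]
  [MeasurableSpace G] [BorelSpace G] (μ : Measure G) [μ.IsHaarMeasure] [IsProbabilityMeasure μ]

theorem measurePreserving_translate_path (b : ℝ → G) (hb : Continuous b) :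
    MeasurePreserving (fun z : ℝ × G ↦ (z.1, z.2 * b z.1)) (volume.prod μ) (volume.prod μ) := by
  refine (MeasurePreserving.id volume).skew_product (g := fun t ω ↦ ω * b t) ?_ ?_
  · exact Continuous.measurable (by fun_prop)
  · exact ae_of_all _ fun t ↦ (measurePreserving_mul_right μ (b t)).map_eq

theorem integrable_kernel_mul_translate (b : ℝ → G) (hb : Continuous b) {ψ : ℝ → ℂ}
    (hψ : Integrable ψ) {f : G → ℂ} (hf : Integrable f μ) :
    Integrable (fun z : ℝ × G ↦ ψ z.1 * f (z.2 * b z.1)) (volume.prod μ) :=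
  (measurePreserving_translate_path μ b hb).integrable_comp_of_integrable (hψ.mul_prod hf)

/-- Fubini, then invariance under ω ↦ ω b(t). For χ = h_j and b the path β, the last factor is the
Fourier transform of ψ at λ_j. -/
theorem fourierCoefficient_convolution (b : ℝ → G) (hb : Continuous b) {ψ : ℝ → ℂ}
    (hψ : Integrable ψ) {f : G → ℂ} (hf : Integrable f μ) (χ : PontryaginDual G) :
    fourierCoefficient μ (fun ω ↦ ∫ t, ψ t * f (ω * b t)) χ =
      fourierCoefficient μ f χ * ∫ t, ψ t * χ (b t) := by
  have hi : Integrable (fun z : ℝ × G ↦ ψ z.1 * f (z.2 * b z.1) * conj (χ z.2 : ℂ))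
      (volume.prod μ) :=
    (integrable_kernel_mul_translate μ b hb hψ hf).mul_bdd (c := 1)
      (Measurable.aestronglyMeasurable
        ((show Continuous fun ω : G ↦ conj (χ ω : ℂ) by fun_prop).measurable.comp measurable_snd))
      (ae_of_all _ fun z ↦ by rw [RCLike.norm_conj, norm_character])
  have hin : ∀ t, ∫ ω, f (ω * b t) * conj (χ ω : ℂ) ∂μ =
      fourierCoefficient μ f χ * χ (b t) := fun t ↦ by
    rw [fourierCoefficient, ← integral_mul_const,
      ← integral_mul_right_eq_self (fun ω ↦ f ω * conj (χ ω : ℂ) * χ (b t)) (b t)]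
    congr 1 with ω
    rw [mul_assoc, map_mul, Circle.coe_mul, map_mul, mul_assoc (conj _), ← Circle.coe_inv_eq_conj,
      ← Circle.coe_inv_eq_conj, ← Circle.coe_mul, inv_mul_cancel, Circle.coe_one, mul_one]
  rw [fourierCoefficient]
  simp_rw [← integral_mul_const]
  rw [integral_integral_swap (f := fun ω t ↦ ψ t * f (ω * b t) * conj (χ ω : ℂ)) hi.swap,
    ← integral_const_mul]
  congr 1 with t
  simp_rw [mul_assoc]
  rw [integral_const_mul, hin]
  ring

open Classical in
theorem fourierCoefficient_character (χ χ' : PontryaginDual G) :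
    fourierCoefficient μ (fun ω ↦ (χ ω : ℂ)) χ' = if χ = χ' then 1 else 0 := by
  split_ifs with h
  · subst h
    have : ∀ ω, (χ ω : ℂ) * conj (χ ω : ℂ) = 1 := fun ω ↦ by
      rw [← Circle.coe_inv_eq_conj, ← Circle.coe_mul, mul_inv_cancel, Circle.coe_one]
    simp [fourierCoefficient, this]
  · obtain ⟨a, ha⟩ : ∃ a, χ a ≠ χ' a := by
      by_contra! hc
      exact h (PontryaginDual.ext hc)
    have h1 := integral_mul_left_eq_self (μ := μ) (fun ω ↦ (χ ω : ℂ) * conj (χ' ω : ℂ)) a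
    have h2 : ∀ ω, (χ (a * ω) : ℂ) * conj (χ' (a * ω) : ℂ) =
        ((χ a * (χ' a)⁻¹ : Circle) : ℂ) * ((χ ω : ℂ) * conj (χ' ω : ℂ)) := fun ω ↦ by
      rw [map_mul, map_mul, Circle.coe_mul, Circle.coe_mul, Circle.coe_mul, map_mul,
        Circle.coe_inv_eq_conj]
      ring
    simp_rw [h2] at h1
    rw [integral_const_mul] at h1
    rw [fourierCoefficient]
    by_contra h0
    have h3 := mul_right_cancel₀ h0 (h1.trans (one_mul _).symm)
    exact ha (mul_inv_eq_one.1 (Circle.coe_eq_one.1 h3))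

set_option linter.unusedSectionVars false in
theorem enorm_fourierCoefficient_le (f : G → ℂ) (χ : PontryaginDual G) :
    ‖fourierCoefficient μ f χ‖ₑ ≤ ∫⁻ ω, ‖f ω‖ₑ ∂μ := by
  refine (enorm_integral_le_lintegral_enorm _).trans_eq ?_
  congr 1 with ω
  rw [enorm_mul, ← ofReal_norm (conj _), RCLike.norm_conj, norm_character, ENNReal.ofReal_one,
    mul_one]

end Convolution

/-! ### Partial sums as averages plus a few extra terms. -/

namespace DirichletGroup

variable {lam : ℕ → ℝ} {G : Type*} [CommGroup G] [TopologicalSpace G]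

/-- The one-parameter subgroup of a Dirichlet group, as a map on `ℝ`. -/
noncomputable def path (D : DirichletGroup lam G) (t : ℝ) : G := D.β (Multiplicative.ofAdd t)

theorem continuous_path (D : DirichletGroup lam G) : Continuous D.path :=
  D.β.continuous_toFun.comp continuous_ofAdd

theorem h_injective (hlam : StrictMono lam) (D : DirichletGroup lam G) :
    Function.Injective D.h := by
  intro j k hjk
  by_contra hne
  have h0 : lam j - lam k ≠ 0 := sub_ne_zero.2 (hlam.injective.ne hne)
  -- At β(s) the two characters differ by the factor -1.
  obtain ⟨s, hs⟩ : ∃ s : ℝ, (lam j - lam k) * s = Real.pi :=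
    ⟨Real.pi / (lam j - lam k), by field_simp⟩
  have h1 := D.h_comp_β j s
  rw [hjk, D.h_comp_β, Complex.exp_eq_exp_iff_exists_int] at h1
  obtain ⟨n, hn⟩ := h1
  have h2 := congrArg Complex.im hn
  simp at h2
  have h3 : (1 : ℝ) = 2 * n := by
    have hp := Real.pi_pos
    have : Real.pi * 1 = Real.pi * (2 * n) := by linarith
    exact mul_left_cancel₀ hp.ne' this
  have h4 : (1 : ℤ) = 2 * n := by exact_mod_cast h3
  omega

variable [IsTopologicalGroup G] [CompactSpace G] [T2Space G] [MeasurableSpace G] [BorelSpace G]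
  (μ : Measure G) [μ.IsHaarMeasure] [μ.Regular] [IsProbabilityMeasure μ]

-- Both sides have the same Fourier coefficients: the multiplier vanishes at λ_k for k ≥ m, as λ_k ≥
-- B there.
open Classical in
theorem convolution_trapezoidKernel_ae_eq (hlam : IsFrequency lam) (D : DirichletGroup lam G)
    {f : G → ℂ} (hf : Integrable f μ)
    (hs : Function.support (fourierCoefficient μ f) ⊆ Set.range D.h) {A B : ℝ} (hA : 0 ≤ A)
    (hAB : A < B) (m : ℕ) (hBm : B ≤ lam m) :
    (fun ω ↦ ∫ t, (trapezoidKernel A B t : ℂ) * f (ω * D.path t)) =ᵐ[μ] fun ω ↦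
      ∑ k ∈ Finset.range m, fourierCoefficient μ f (D.h k) * trapezoid A B (lam k) *
        (D.h k ω : ℂ) := by
  have hψ : Integrable fun t ↦ (trapezoidKernel A B t : ℂ) :=
    (integrable_trapezoidKernel A B).ofReal
  have hint : ∀ (a : ℂ) (χ : PontryaginDual G), Integrable (fun ω ↦ a * (χ ω : ℂ)) μ :=
    fun a χ ↦ Continuous.integrable_of_hasCompactSupport (by fun_prop)
      (HasCompactSupport.of_compactSpace _)
  refine ae_eq_of_fourierCoefficient_eq μ _ _ ?_ (integrable_finsetSum _ fun k _ ↦ hint _ _)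
    fun χ ↦ ?_
  · exact (integrable_kernel_mul_translate μ D.path D.continuous_path hψ hf).integral_prod_right
  rw [fourierCoefficient_convolution μ D.path D.continuous_path hψ hf]
  have hR : fourierCoefficient μ (fun ω ↦ ∑ k ∈ Finset.range m,
      fourierCoefficient μ f (D.h k) * trapezoid A B (lam k) * (D.h k ω : ℂ)) χ =
      ∑ k ∈ Finset.range m, if D.h k = χ then
        fourierCoefficient μ f (D.h k) * trapezoid A B (lam k) else 0 := by
    rw [fourierCoefficient]
    simp_rw [Finset.sum_mul]
    rw [integral_finsetSum _ fun k _ ↦ integrable_mul_conj_character μ (hint _ _) χ]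
    refine Finset.sum_congr rfl fun k _ ↦ ?_
    simp_rw [mul_assoc (_ * _ : ℂ)]
    rw [integral_const_mul]
    refine (congrArg _ (fourierCoefficient_character μ (D.h k) χ)).trans ?_
    rw [mul_ite, mul_one, mul_zero]
  rw [hR]
  by_cases hχ : χ ∈ Set.range D.h
  · obtain ⟨j, rfl⟩ := hχ
    have e : ∀ t, (D.h j (D.path t) : ℂ) = Complex.exp (-(Complex.I * (lam j : ℂ) * (t : ℂ))) :=
      D.h_comp_β j
    simp_rw [e]
    rw [integral_trapezoidKernel_mul_exp]
    simp_rw [(D.h_injective hlam.strictMono).eq_iff]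
    rw [Finset.sum_ite_eq' (Finset.range m) j]
    split_ifs with hj
    · rfl
    · rw [Finset.mem_range, not_lt] at hj
      rw [trapezoid_eq_zero hA hAB (hBm.trans (hlam.strictMono.monotone hj))]
      simp
  · have h0 : fourierCoefficient μ f χ = 0 := by
      by_contra hc
      exact hχ (hs hc)
    rw [h0, zero_mul, Finset.sum_eq_zero]
    intro k _
    rw [if_neg fun hk ↦ hχ ⟨k, hk⟩]

/-- With A = λ_n the multiplier is 1 for k ≤ n, so the average exceeds S_n f only by the terms n < k
< m, each bounded by ‖f‖₁. -/
theorem enorm_partialSum_le (hlam : IsFrequency lam) (D : DirichletGroup lam G)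
    {f : G → ℂ} (hf : Integrable f μ)
    (hs : Function.support (fourierCoefficient μ f) ⊆ Set.range D.h) {B M d : ℝ} {n m : ℕ}
    (hnm : n < m) (hBm : B ≤ lam m) (hBM : B ≤ M) (hd : 0 < d) (hdB : d ≤ B - lam n) :
    ∀ᵐ ω ∂μ, ‖D.partialSum μ f n ω‖ₑ ≤
      (∫⁻ t, ENNReal.ofReal (kernelMajorant M d t / fejerConst) * ‖f (ω * D.path t)‖ₑ) +
        ENNReal.ofReal (m - n) * ∫⁻ ω, ‖f ω‖ₑ ∂μ := by
  have hAB : lam n < B := by linarith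
  filter_upwards [convolution_trapezoidKernel_ae_eq μ hlam D hf hs (hlam.nonneg n) hAB m hBm]
    with ω hω
  rw [← Finset.sum_range_add_sum_Ico _ (Nat.succ_le_of_lt hnm)] at hω
  have h1 : ∑ k ∈ Finset.range n.succ, fourierCoefficient μ f (D.h k) *
      trapezoid (lam n) B (lam k) * (D.h k ω : ℂ) = D.partialSum μ f n ω := by
    refine Finset.sum_congr rfl fun k hk ↦ ?_
    rw [trapezoid_eq_one hAB (hlam.nonneg k) (hlam.strictMono.monotone
      (Nat.lt_succ_iff.1 (Finset.mem_range.1 hk))), Complex.ofReal_one, mul_one]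
  rw [h1] at hω
  rw [eq_sub_of_add_eq hω.symm]
  refine enorm_sub_le.trans (add_le_add ?_ ?_)
  · refine (enorm_integral_le_lintegral_enorm _).trans (lintegral_mono_ae ?_)
    filter_upwards [Measure.ae_ne volume (0 : ℝ)] with t ht
    rw [enorm_mul]
    gcongr
    rw [← ofReal_norm, Complex.norm_real]
    exact ENNReal.ofReal_le_ofReal (abs_trapezoidKernel_le (hlam.nonneg n) hBM hd hdB ht)
  · refine (enorm_sum_le _ _).trans ?_
    have hk : ∀ k ∈ Finset.Ico n.succ m, ‖fourierCoefficient μ f (D.h k) *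
        trapezoid (lam n) B (lam k) * (D.h k ω : ℂ)‖ₑ ≤ ∫⁻ ω, ‖f ω‖ₑ ∂μ := fun k _ ↦ by
      rw [enorm_mul, enorm_mul, ← ofReal_norm (D.h k ω : ℂ), norm_character, ENNReal.ofReal_one,
        mul_one, ← mul_one (∫⁻ ω, ‖f ω‖ₑ ∂μ)]
      gcongr
      · exact enorm_fourierCoefficient_le μ f _
      · rw [← ofReal_norm, ENNReal.ofReal_le_one, Complex.norm_real]
        exact abs_trapezoid_le_one hAB _
    refine (Finset.sum_le_card_nsmul _ _ _ hk).trans ?_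
    rw [nsmul_eq_mul, Nat.card_Ico]
    gcongr
    rw [← ENNReal.ofReal_natCast]
    refine ENNReal.ofReal_le_ofReal ?_
    rw [Nat.cast_sub (Nat.succ_le_of_lt hnm)]
    push_cast
    linarith

end DirichletGroup

/-! ### A common majorant from (NC). -/

/-- Under (NC), the kernels for all frequencies `≤ x` have a common majorant whose mass grows
subexponentially in `x`. -/
theorem SatisfiesNC.exists_majorant {lam : ℕ → ℝ} (hlam : IsFrequency lam)
    (hNC : SatisfiesNC lam) (δ : ℝ) (hδ : 0 < δ) :
    ∃ C : ℝ, 0 < C ∧ ∀ x : ℝ, 0 ≤ x → ∃ M d c : ℝ, 0 < d ∧ d ≤ M ∧ 0 ≤ c ∧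
      2 * (3 + Real.log (M / d)) / fejerConst + c ≤ C * Real.exp (δ * x) ∧
      ∀ n, lam n ≤ x → ∃ (m : ℕ) (B : ℝ), n < m ∧ B ≤ lam m ∧ B ≤ M ∧ d ≤ B - lam n ∧
        (m : ℝ) - n ≤ c := by
  obtain ⟨C₀, hC₀, hm⟩ := hNC δ hδ
  have hc := fejerConst_pos
  have hl1 : 0 < lam 1 := (hlam.nonneg 0).trans_lt (hlam.strictMono one_pos)
  -- λ₀ may be 0, but every m > n has index at least 1, so λ_m ≥ l > 0.
  set l := min 1 (lam 1) with hl
  have hl0 : 0 < l := lt_min one_pos hl1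
  have hlog : Real.log l ≤ 0 := Real.log_nonpos hl0.le (min_le_left _ _)
  refine ⟨2 * (3 + (1 / δ + C₀ - Real.log l)) / fejerConst + C₀, ?_, fun x hx ↦ ?_⟩
  · have : 0 < 3 + (1 / δ + C₀ - Real.log l) := by
      have : 0 < 1 / δ := by positivity
      linarith
    positivity
  have hE : 1 ≤ Real.exp (δ * x) := Real.one_le_exp (by positivity)
  set E := Real.exp (δ * x) with hEdef
  have hCE : 0 ≤ C₀ * E := by positivity
  have hexp : Real.exp (-(C₀ * E)) ≤ 1 := Real.exp_le_one_iff.2 (by linarith)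
  have hd0 : 0 < l * Real.exp (-(C₀ * E)) := by positivity
  have hd1 : l * Real.exp (-(C₀ * E)) ≤ 1 :=
    mul_le_one₀ (min_le_left _ _) (Real.exp_pos _).le hexp
  refine ⟨x + 1, l * Real.exp (-(C₀ * E)), C₀ * E, hd0, by linarith, hCE, ?_, fun n hn ↦ ?_⟩
  · have h1 : Real.log ((x + 1) / (l * Real.exp (-(C₀ * E)))) =
        Real.log (x + 1) - Real.log l + C₀ * E := by
      rw [Real.log_div (by linarith) hd0.ne', Real.log_mul hl0.ne' (Real.exp_pos _).ne',
        Real.log_exp]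
      ring
    have h2 : Real.log (x + 1) ≤ 1 / δ * E := by
      have h3 := Real.log_le_sub_one_of_pos (show 0 < x + 1 by linarith)
      have h4 := Real.add_one_le_exp (δ * x)
      have h5 : x = 1 / δ * (δ * x) := by field_simp
      have h6 : 1 / δ * (δ * x) ≤ 1 / δ * E := by
        gcongr; linarith
      linarith
    rw [h1, add_mul, div_mul_eq_mul_div]
    gcongr ?_ / _ + _
    nlinarith [mul_le_mul_of_nonneg_left hE (neg_nonneg.2 hlog)]
  · obtain ⟨m, hnm, hmC⟩ := hm n
    have hlt : lam n < lam m := hlam.strictMono hnm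
    have h0n := hlam.nonneg n
    have hEn : C₀ * Real.exp (δ * lam n) ≤ C₀ * E := by
      rw [hEdef]; gcongr
    have hnm' : (n : ℝ) < m := by exact_mod_cast hnm
    have hratio : 1 ≤ (lam m + lam n) / (lam m - lam n) := by
      rw [one_le_div (by linarith)]; linarith
    have hlogr := Real.log_nonneg hratio
    have hcard : (m : ℝ) - n ≤ C₀ * E := by linarith
    have hl_le : l ≤ lam m :=
      (min_le_right _ _).trans (hlam.strictMono.monotone (by omega))
    -- (NC) gives λ_m + λ_n ≤ e^{C₀E}(λ_m - λ_n), and the left side is at least l.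
    have hgap : l * Real.exp (-(C₀ * E)) ≤ lam m - lam n := by
      have h1 : (lam m + lam n) / (lam m - lam n) ≤ Real.exp (C₀ * E) := by
        rw [← Real.log_le_iff_le_exp (by linarith)]
        linarith
      rw [div_le_iff₀ (by linarith)] at h1
      rw [Real.exp_neg, ← div_eq_mul_inv, div_le_iff₀ (Real.exp_pos _)]
      linarith
    -- Truncating at λ_n + 1 keeps B ≤ x + 1 even when λ_m is very large.
    refine ⟨m, min (lam m) (lam n + 1), hnm, min_le_left _ _,
      (min_le_right _ _).trans (by linarith), ?_, hcard⟩
    rw [le_sub_iff_add_le]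
    exact le_min (by linarith) (by linarith)

/-! ### The maximal inequalities in L^p. -/

namespace DirichletGroup

variable {lam : ℕ → ℝ} {G : Type*} [CommGroup G] [TopologicalSpace G] [IsTopologicalGroup G]
  [MeasurableSpace G] [BorelSpace G]
  (μ : Measure G) [μ.IsHaarMeasure] [IsProbabilityMeasure μ]

theorem measurable_lintegral_path (D : DirichletGroup lam G) {f : G → ℂ} (hf : Measurable f)
    {w : ℝ → ℝ≥0∞} (hw : Measurable w) :
    Measurable fun ω ↦ ∫⁻ t, w t * ‖f (ω * D.path t)‖ₑ := by
  have hb := D.continuous_path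
  have h1 : Measurable fun z : G × ℝ ↦ f (z.1 * D.path z.2) :=
    hf.comp (Continuous.measurable (by fun_prop))
  exact ((hw.comp measurable_snd).mul h1.enorm).lintegral_prod_right'

/-- Averaging along the one-parameter subgroup is bounded on `L^p`. -/
theorem eLpNorm_average_le (D : DirichletGroup lam G) {f : G → ℂ} (hf : Measurable f)
    {w : ℝ → ℝ≥0∞} (hw : Measurable w) (hwfin : ∫⁻ t, w t ≠ ∞) (c : ℝ≥0∞) (p : ℝ≥0∞)
    (hp : 1 ≤ p) :
    eLpNorm (fun ω ↦ (∫⁻ t, w t * ‖f (ω * D.path t)‖ₑ) + c * ∫⁻ ω, ‖f ω‖ₑ ∂μ) p μ ≤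
      ((∫⁻ t, w t) + c) * eLpNorm f p μ := by
  have hb := D.continuous_path
  have hmeas := D.measurable_lintegral_path hf hw
  refine (eLpNorm_add_le hmeas.aestronglyMeasurable aestronglyMeasurable_const hp).trans ?_
  rw [add_mul]
  refine add_le_add ?_ ?_
  -- Minkowski is applied to the finite measure w(t) dt; the constant term uses ‖f‖₁ ≤ ‖f‖_p on a
  -- probability space.
  · have hν : (volume.withDensity w) Set.univ = ∫⁻ t, w t := by
      rw [withDensity_apply _ MeasurableSet.univ, Measure.restrict_univ]
    have : IsFiniteMeasure (volume.withDensity w) := ⟨by rw [hν]; exact hwfin.lt_top⟩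
    have h := eLpNorm_lintegral_comp_le μ (volume.withDensity w) (fun ω t ↦ ω * D.path t)
      (Continuous.measurable (by fun_prop)) (fun t ↦ measurePreserving_mul_right μ (D.path t))
      (fun ω ↦ ‖f ω‖ₑ) hf.enorm p hp
    rw [hν, eLpNorm_enorm] at h
    refine le_trans (le_of_eq ?_) h
    congr 1 with ω
    refine (lintegral_withDensity_eq_lintegral_mul volume hw (Measurable.enorm ?_)).symm
    exact hf.comp (Continuous.measurable (by fun_prop))
  · rw [eLpNorm_const _ (one_pos.trans_le hp).ne' (IsProbabilityMeasure.ne_zero μ), measure_univ,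
      ENNReal.one_rpow, mul_one, enorm_eq_self]
    gcongr
    rw [← eLpNorm_one_eq_lintegral_enorm]
    exact eLpNorm_le_eLpNorm_of_exponent_le hp hf.aestronglyMeasurable

end DirichletGroup

universe u

theorem lintegral_kernelMajorant_div_le {M d : ℝ} (hd : 0 < d) (hdM : d ≤ M) :
    ∫⁻ t, ENNReal.ofReal (kernelMajorant M d t / fejerConst) ≤
      ENNReal.ofReal (2 * (3 + Real.log (M / d)) / fejerConst) := by
  have hc := inv_pos.2 fejerConst_pos
  simp_rw [div_eq_mul_inv _ fejerConst, ENNReal.ofReal_mul' hc.le]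
  rw [lintegral_mul_const _ (measurable_kernelMajorant M d).ennreal_ofReal]
  gcongr
  exact lintegral_kernelMajorant_le hd hdM

/-- The weight `w` and constant `c` are fixed before the group, `f` and `n`; this uniformity lets
the supremum over `n` pass inside the norm. -/
theorem SatisfiesNC.exists_partialSum_majorant {lam : ℕ → ℝ} (hlam : IsFrequency lam)
    (hNC : SatisfiesNC lam) (δ : ℝ) (hδ : 0 < δ) :
    ∃ C : ℝ, 0 < C ∧ ∀ x : ℝ, 0 ≤ x → ∃ (w : ℝ → ℝ≥0∞) (c : ℝ≥0∞), Measurable w ∧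
      (∫⁻ t, w t) + c ≤ ENNReal.ofReal (C * Real.exp (δ * x)) ∧
      ∀ (G : Type u) [CommGroup G] [TopologicalSpace G] [IsTopologicalGroup G] [CompactSpace G]
        [T2Space G] [MeasurableSpace G] [BorelSpace G]
        (μ : Measure G) [μ.IsHaarMeasure] [μ.Regular] [IsProbabilityMeasure μ]
        (D : DirichletGroup lam G) (f : G → ℂ), Integrable f μ →
        Function.support (fourierCoefficient μ f) ⊆ Set.range D.h → ∀ n, lam n ≤ x →
        ∀ᵐ ω ∂μ, ‖D.partialSum μ f n ω‖ₑ ≤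
          (∫⁻ t, w t * ‖f (ω * D.path t)‖ₑ) + c * ∫⁻ ω, ‖f ω‖ₑ ∂μ := by
  obtain ⟨C, hC, h⟩ := hNC.exists_majorant hlam δ hδ
  refine ⟨C, hC, fun x hx ↦ ?_⟩
  obtain ⟨M, d, c, hd, hdM, hc, hmass, hn⟩ := h x hx
  refine ⟨fun t ↦ ENNReal.ofReal (kernelMajorant M d t / fejerConst), ENNReal.ofReal c,
    ((measurable_kernelMajorant M d).div_const _).ennreal_ofReal, ?_, ?_⟩
  · refine (add_le_add_left (lintegral_kernelMajorant_div_le hd hdM) _).trans ?_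
    have hlog : 0 ≤ Real.log (M / d) := Real.log_nonneg ((one_le_div hd).2 hdM)
    have := fejerConst_pos
    rw [← ENNReal.ofReal_add (by positivity) hc]
    exact ENNReal.ofReal_le_ofReal hmass
  · intro G _ _ _ _ _ _ _ μ _ _ _ D f hf hs n hnx
    obtain ⟨m, B, hnm, hBm, hBM, hdB, hmc⟩ := hn n hnx
    filter_upwards [D.enorm_partialSum_le μ hlam hf hs hnm hBm hBM hd hdB] with ω hω
    refine hω.trans ?_
    gcongr

theorem eLpNorm_iSup_partialSum_le {lam : ℕ → ℝ} (hlam : IsFrequency lam)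
    (hNC : SatisfiesNC lam) (δ : ℝ) (hδ : 0 < δ) :
    ∃ C : ℝ, 0 < C ∧
      ∀ (G : Type u) [CommGroup G] [TopologicalSpace G] [IsTopologicalGroup G] [CompactSpace G]
        [T2Space G] [MeasurableSpace G] [BorelSpace G]
        (μ : Measure G) [μ.IsHaarMeasure] [μ.Regular] [IsProbabilityMeasure μ]
        (D : DirichletGroup lam G) (p : ℝ≥0∞), 1 ≤ p → ∀ f : G → ℂ, Measurable f →
        D.MemHardy μ p f → ∀ N : ℕ,
          eLpNorm (fun ω => ⨆ n : ℕ, ⨆ _ : n ≤ N, ‖D.partialSum μ f n ω‖ₑ) p μ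
            ≤ ENNReal.ofReal (C * Real.exp (δ * lam N)) * eLpNorm f p μ := by
  obtain ⟨C, hC, h⟩ := SatisfiesNC.exists_partialSum_majorant.{u} hlam hNC δ hδ
  refine ⟨C, hC, fun G _ _ _ _ _ _ _ μ _ _ _ D p hp f hfm hf N ↦ ?_⟩
  obtain ⟨w, c, hw, hwc, hmaj⟩ := h (lam N) (hlam.nonneg N)
  have hae : ∀ᵐ ω ∂μ, ∀ n, n ≤ N → ‖D.partialSum μ f n ω‖ₑ ≤
      (∫⁻ t, w t * ‖f (ω * D.path t)‖ₑ) + c * ∫⁻ ω, ‖f ω‖ₑ ∂μ :=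
    ae_all_iff.2 fun n ↦ eventually_imp_distrib_left.2 fun hn ↦
      hmaj G μ D f (hf.1.integrable hp) hf.2 n (hlam.strictMono.monotone hn)
  have hfin : ∫⁻ t, w t ≠ ∞ :=
    ((le_self_add.trans hwc).trans_lt ENNReal.ofReal_lt_top).ne
  calc _ ≤ eLpNorm (fun ω ↦ (∫⁻ t, w t * ‖f (ω * D.path t)‖ₑ) + c * ∫⁻ ω, ‖f ω‖ₑ ∂μ) p μ := by
        refine eLpNorm_mono_enorm_ae ?_
        filter_upwards [hae] with ω hω
        simpa only [enorm_eq_self, iSup_le_iff] using hω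
    _ ≤ ((∫⁻ t, w t) + c) * eLpNorm f p μ := D.eLpNorm_average_le μ hfm hw hfin c p hp
    _ ≤ _ := by gcongr

theorem eLpNorm_iSup_weighted_partialSum_le {lam : ℕ → ℝ} (hlam : IsFrequency lam)
    (hNC : SatisfiesNC lam) (δ : ℝ) (hδ : 0 < δ) :
    ∃ C : ℝ, 0 < C ∧
      ∀ (G : Type u) [CommGroup G] [TopologicalSpace G] [IsTopologicalGroup G] [CompactSpace G]
        [T2Space G] [MeasurableSpace G] [BorelSpace G]
        (μ : Measure G) [μ.IsHaarMeasure] [μ.Regular] [IsProbabilityMeasure μ]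
        (D : DirichletGroup lam G) (p : ℝ≥0∞), 1 ≤ p → ∀ f : G → ℂ, Measurable f →
        D.MemHardy μ p f →
          eLpNorm (fun ω => ⨆ N : ℕ,
              ENNReal.ofReal (Real.exp (-(δ * lam N))) * ‖D.partialSum μ f N ω‖ₑ) p μ
            ≤ ENNReal.ofReal C * eLpNorm f p μ := by
  obtain ⟨C, hC, h⟩ := SatisfiesNC.exists_partialSum_majorant.{u} hlam hNC (δ / 2) (by positivity)
  choose w c hw hwc hmaj using fun j : ℕ ↦ h j j.cast_nonneg
  -- For j = ⌈λ_N⌉ one has j - 1 < λ_N, so `a j` dominates e^{-δλ_N}. Against masses O(e^{δj/2})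
  -- these weights leave a geometric series.
  let a : ℕ → ℝ≥0∞ := fun j ↦ ENNReal.ofReal (Real.exp (-(δ * (j - 1))))
  let W : ℝ → ℝ≥0∞ := fun t ↦ ∑' j, a j * w j t
  let K : ℝ≥0∞ := ∑' j, a j * c j
  have hW : Measurable W := Measurable.tsum fun j ↦ (hw j).const_mul _
  have hsum : Summable fun j : ℕ ↦ C * Real.exp δ * Real.exp (-(δ / 2)) ^ j :=
    (summable_geometric_of_lt_one (Real.exp_pos _).le
      (by rw [← Real.exp_zero]; exact Real.exp_lt_exp.2 (by linarith))).mul_left _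
  have hWK : (∫⁻ t, W t) + K ≤
      ENNReal.ofReal (∑' j : ℕ, C * Real.exp δ * Real.exp (-(δ / 2)) ^ j) := by
    rw [lintegral_tsum fun j ↦ ((hw j).const_mul _).aemeasurable, ← ENNReal.tsum_add,
      ENNReal.ofReal_tsum_of_nonneg (fun j ↦ by positivity) hsum]
    refine ENNReal.tsum_le_tsum fun j ↦ ?_
    rw [lintegral_const_mul _ (hw j), ← mul_add]
    refine (mul_le_mul_right (hwc j) _).trans_eq ?_
    rw [← ENNReal.ofReal_mul (Real.exp_pos _).le]
    congr 1
    rw [mul_left_comm, mul_assoc, ← Real.exp_nat_mul, ← Real.exp_add, ← Real.exp_add]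
    ring_nf
  have hC' : 0 < ∑' j : ℕ, C * Real.exp δ * Real.exp (-(δ / 2)) ^ j :=
    hsum.tsum_pos (fun j ↦ by positivity) 0 (by positivity)
  refine ⟨_, hC', fun G _ _ _ _ _ _ _ μ _ _ _ D p hp f hfm hf ↦ ?_⟩
  have hae : ∀ᵐ ω ∂μ, ∀ j n, lam n ≤ (j : ℕ) → ‖D.partialSum μ f n ω‖ₑ ≤
      (∫⁻ t, w j t * ‖f (ω * D.path t)‖ₑ) + c j * ∫⁻ ω, ‖f ω‖ₑ ∂μ :=
    ae_all_iff.2 fun j ↦ ae_all_iff.2 fun n ↦ eventually_imp_distrib_left.2 fun hn ↦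
      hmaj j G μ D f (hf.1.integrable hp) hf.2 n hn
  have hfin : ∫⁻ t, W t ≠ ∞ :=
    ((le_self_add.trans hWK).trans_lt ENNReal.ofReal_lt_top).ne
  calc _ ≤ eLpNorm (fun ω ↦ (∫⁻ t, W t * ‖f (ω * D.path t)‖ₑ) + K * ∫⁻ ω, ‖f ω‖ₑ ∂μ) p μ := by
        refine eLpNorm_mono_enorm_ae ?_
        filter_upwards [hae] with ω hω
        simp only [enorm_eq_self]
        refine iSup_le fun N ↦ ?_
        have hceil := Nat.ceil_lt_add_one (hlam.nonneg N)
        have h1 := hω ⌈lam N⌉₊ N (Nat.le_ceil _)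
        have h2 : ENNReal.ofReal (Real.exp (-(δ * lam N))) ≤ a ⌈lam N⌉₊ := by
          refine ENNReal.ofReal_le_ofReal (Real.exp_le_exp.2 (neg_le_neg ?_))
          gcongr
          linarith
        refine (mul_le_mul' h2 h1).trans ?_
        rw [mul_add, ← mul_assoc]
        have hfm' : Measurable fun t ↦ ‖f (ω * D.path t)‖ₑ := by
          have hb := D.continuous_path
          exact (hfm.comp (Continuous.measurable (by fun_prop))).enorm
        rw [← lintegral_const_mul (f := fun t ↦ w ⌈lam N⌉₊ t * ‖f (ω * D.path t)‖ₑ) _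
          ((hw _).mul hfm')]
        simp_rw [← mul_assoc]
        gcongr with t
        · exact ENNReal.le_tsum (f := fun j ↦ a j * w j t) _
        · exact ENNReal.le_tsum (f := fun j ↦ a j * c j) _
    _ ≤ ((∫⁻ t, W t) + K) * eLpNorm f p μ := D.eLpNorm_average_le μ hfm hW hfin K p hp
    _ ≤ _ := by gcongr

theorem fourierCoefficient_congr_ae {G : Type*} [CommGroup G] [TopologicalSpace G]
    [MeasurableSpace G] {μ : Measure G} {f g : G → ℂ} (h : f =ᵐ[μ] g) :
    fourierCoefficient μ f = fourierCoefficient μ g := by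
  funext χ
  refine integral_congr_ae ?_
  filter_upwards [h] with x hx
  rw [hx]

theorem mainTheorem3 (lam : ℕ → ℝ) (hlam : IsFrequency lam) (hNC : SatisfiesNC lam)
    (δ : ℝ) (hδ : 0 < δ) :
    ∃ C : ℝ, 0 < C ∧
      ∀ (G : Type*) [CommGroup G] [TopologicalSpace G] [IsTopologicalGroup G] [CompactSpace G]
        [T2Space G] [MeasurableSpace G] [BorelSpace G]
        (μ : Measure G) [μ.IsHaarMeasure] [μ.Regular] [IsProbabilityMeasure μ]
        (D : DirichletGroup lam G) (p : ℝ≥0∞), 1 ≤ p →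
        ∀ f : G → ℂ, D.MemHardy μ p f →
          (∀ N : ℕ,
            eLpNorm (fun ω => ⨆ n : ℕ, ⨆ _ : n ≤ N, ‖D.partialSum μ f n ω‖ₑ) p μ
              ≤ ENNReal.ofReal (C * Real.exp (δ * lam N)) * eLpNorm f p μ) ∧
          eLpNorm (fun ω => ⨆ N : ℕ,
              ENNReal.ofReal (Real.exp (-(δ * lam N))) * ‖D.partialSum μ f N ω‖ₑ) p μ
            ≤ ENNReal.ofReal C * eLpNorm f p μ := by
  obtain ⟨C₁, hC₁, h₁⟩ := eLpNorm_iSup_partialSum_le hlam hNC δ hδ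
  obtain ⟨C₂, hC₂, h₂⟩ := eLpNorm_iSup_weighted_partialSum_le hlam hNC δ hδ
  refine ⟨max C₁ C₂, lt_max_of_lt_left hC₁, fun G _ _ _ _ _ _ _ μ _ _ _ D p hp f hf ↦ ?_⟩
  -- Passing to a measurable representative is harmless: the partial sums depend only on the Fourier
  -- coefficients.
  obtain ⟨g, hg, hfg⟩ : ∃ g : G → ℂ, Measurable g ∧ f =ᵐ[μ] g :=
    ⟨hf.1.1.mk f, hf.1.1.stronglyMeasurable_mk.measurable, hf.1.1.ae_eq_mk⟩
  have hcoef := fourierCoefficient_congr_ae hfg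
  have hS : D.partialSum μ f = D.partialSum μ g := by
    funext n ω
    simp only [DirichletGroup.partialSum, hcoef]
  have hgH : D.MemHardy μ p g := ⟨hf.1.ae_eq hfg, hcoef ▸ hf.2⟩
  rw [hS, eLpNorm_congr_ae hfg]
  refine ⟨fun N ↦ (h₁ G μ D p hp g hg hgH N).trans ?_, (h₂ G μ D p hp g hg hgH).trans ?_⟩
  · gcongr
    exact le_max_left _ _
  · gcongr
    exact le_max_right _ _
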